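/- Let $\mathbb{K}$ be a field of characteristic zero. A (finite) graph $\Gamma$ is a finite set of half-edges together with a partition of it into pairs (the edges), a partition of it into nonempty blocks (the vertices), and a subset of the one-element vertices (the external vertices); the other vertices are called internal. An edge is external if it is incident to an external vertex and internal otherwise. Isomorphisms are bijections of half-edges preserving these structures. The empty graph is denoted $\mathbf 1$ and is not connected. Let $\mathcal H$ be the vector space freely spanned by the isomorphism classes of graphs, an algebra under disjoint union $\sqcup$, and let $\nabla:\mathcal H\to\mathcal H\otimes\mathcal H$ be the algebra map given on connected graphs by $$\nabla(\Gamma)=\mathbf 1\otimes\Gamma+\Gamma\otimes\mathbf 1+\sum_{\gamma}\gamma\otimes\Gamma/\gamma ,$$ where $\gamma$ runs over all sets of internal edges of $\Gamma$ other than the empty set and the set of all internal edges. Here $\Gamma/\gamma$ is obtained by contracting the edges of $\gamma$, and $\gamma$ is regarded as the graph consisting of the vertices of $\Gamma$ that meet an edge of $\gamma$, with all their half-edges and the edges of $\gamma$, in which every half-edge not belonging to $\gamma$ is completed to an external edge by a new external vertex. Let $\widehat{\mathcal H}$ be the space of formal infinite linear combinations of isomorphism classes of graphs, let $I:\widehat{\mathcal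 H}\to\mathcal H^*$ be the isomorphism $\Gamma\mapsto|\mathrm{Aut}(\Gamma)|\langle\Gamma,-\rangle$, where $\langle\Gamma,\Gamma'\rangle$ is $1$ if $\Gamma\cong\Gamma'$ and $0$ otherwise, and let $\star$ be the product on $\widehat{\mathcal H}$ dual to $\nabla$, that is, $I(x\star y)=(I(x)\otimes I(y))\circ\nabla$. Put $[x,y]=x\star y-y\star x$. For connected graphs $\Gamma_1,\Gamma_2$, each having at least one internal edge, let $$\Gamma_1\circ\Gamma_2=\sum_{v}\ \sum_{\sigma}\ \Gamma_{v,\sigma},$$ where $v$ runs over the internal vertices of $\Gamma_2$, $\sigma$ runs over the bijections from the half-edges at $v$ to the external vertices of $\Gamma_1$ (there are none unless the valency of $v$ equals the number of external vertices of $\Gamma_1$), and $\Gamma_{v,\sigma}$ is the graph obtained by inserting $\Gamma_1$ into $\Gamma_2$ at $v$: its edges are the edges of $\Gamma_2$ and the internal edges of $\Gamma_1$, the vertex $v$ is removed, each half-edge $h$ of $v$ is attached to the internal vertex of $\Gamma_1$ that is joined by an external edge to the external vertex $\sigma(h)$, and its external vertices are those of $\Gamma_2$. Theorem. For all connected graphs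 $\Gamma_1,\Gamma_2$, each having at least one internal edge, $$[\Gamma_1,\Gamma_2]=\Gamma_1\circ\Gamma_2-\Gamma_2\circ\Gamma_1 .$$ -/

import Mathlib

open scoped TensorProduct

/-- A finite graph given by its half-edges. The edges (a partition of the half-edges into pairs)
are the orbits `{h, mate h}` of a fixed-point-free involution, the vertices are the classes of the
equivalence relation `vert`, and the external vertices, which are one-element classes `{x}`,
are recorded by their unique half-edge: `ext` is the set of these `x`. -/
structure FGraph : Type 1 where
  HalfEdge : Type
  finite : Finite HalfEdge
  mate : HalfEdge → HalfEdge
  mate_mate : ∀ h, mate (mate h) = h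
  mate_ne : ∀ h, mate h ≠ h
  vert : Setoid HalfEdge
  ext : Set HalfEdge
  ext_univalent : ∀ x ∈ ext, ∀ h, vert x h → h = x

namespace FGraph

attribute [instance] FGraph.finite

/-- Isomorphisms: bijections of half-edges preserving edges, vertices and external vertices. -/
structure Iso (Γ Γ' : FGraph) where
  toEquiv : Γ.HalfEdge ≃ Γ'.HalfEdge
  map_mate : ∀ h, toEquiv (Γ.mate h) = Γ'.mate (toEquiv h)
  map_vert : ∀ a b, Γ.vert a b ↔ Γ'.vert (toEquiv a) (toEquiv b)
  map_ext : ∀ h, h ∈ Γ.ext ↔ toEquiv h ∈ Γ'.ext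

namespace Iso

theorem toEquiv_injective {Γ Γ' : FGraph} :
    Function.Injective (Iso.toEquiv : Iso Γ Γ' → (Γ.HalfEdge ≃ Γ'.HalfEdge)) := by
  rintro ⟨e, _, _, _⟩ ⟨f, _, _, _⟩ h
  cases h
  rfl

def refl (Γ : FGraph) : Iso Γ Γ := ⟨Equiv.refl _, fun _ => rfl, fun _ _ => Iff.rfl, fun _ => Iff.rfl⟩

def symm {Γ Γ' : FGraph} (e : Iso Γ Γ') : Iso Γ' Γ where
  toEquiv := e.toEquiv.symm
  map_mate h := by
    rw [Equiv.symm_apply_eq, e.map_mate, Equiv.apply_symm_apply]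
  map_vert a b := by
    rw [e.map_vert, Equiv.apply_symm_apply, Equiv.apply_symm_apply]
  map_ext h := by rw [e.map_ext, Equiv.apply_symm_apply]

def trans {Γ Γ' Γ'' : FGraph} (e : Iso Γ Γ') (f : Iso Γ' Γ'') : Iso Γ Γ'' where
  toEquiv := e.toEquiv.trans f.toEquiv
  map_mate h := by simp [e.map_mate, f.map_mate]
  map_vert a b := by simp [e.map_vert, f.map_vert]
  map_ext h := by simp [e.map_ext, f.map_ext]

end Iso

instance (Γ Γ' : FGraph) : Finite (Iso Γ Γ') :=
  Finite.of_injective _ Iso.toEquiv_injective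

/-- The order of the automorphism group of a graph. -/
noncomputable def autCard (Γ : FGraph) : ℕ := Nat.card (Iso Γ Γ)

theorem autCard_congr {Γ Γ' : FGraph} (e : Iso Γ Γ') : Γ.autCard = Γ'.autCard := by
  refine Nat.card_congr ⟨fun f => (e.symm.trans f).trans e, fun f => (e.trans f).trans e.symm,
    fun f => ?_, fun f => ?_⟩ <;>
  · apply Iso.toEquiv_injective
    ext x
    simp [Iso.trans, Iso.symm]

theorem autCard_ne_zero (Γ : FGraph) : Γ.autCard ≠ 0 := by
  have : Nonempty (Iso Γ Γ) := ⟨Iso.refl Γ⟩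
  exact Nat.card_pos.ne'

/-- A half-edge is internal if it belongs to an internal edge,
that is, to an edge none of whose two ends is an external vertex. -/
def IsInternal (Γ : FGraph) (h : Γ.HalfEdge) : Prop := h ∉ Γ.ext ∧ Γ.mate h ∉ Γ.ext

/-- The graph has at least one internal edge. -/
def HasInternalEdge (Γ : FGraph) : Prop := ∃ h, Γ.IsInternal h

/-- Two half-edges are adjacent if they lie at the same vertex or form an edge. -/
def Adj (Γ : FGraph) (a b : Γ.HalfEdge) : Prop := Γ.vert a b ∨ b = Γ.mate a

/-- The relation of lying in the same connected component. -/
def conn (Γ : FGraph) : Setoid Γ.HalfEdge := Relation.EqvGen.setoid Γ.Adj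

/-- Connected graphs; the empty graph is not connected. -/
def Connected (Γ : FGraph) : Prop := Nonempty Γ.HalfEdge ∧ ∀ a b, Γ.conn a b

/-! ### Disjoint unions -/

/-- The equivalence relation on a disjoint sum whose classes are those of the two summands. -/
def sumSetoid {α β : Type} (s : Setoid α) (t : Setoid β) : Setoid (α ⊕ β) where
  r x y :=
    match x, y with
    | .inl a, .inl b => s a b
    | .inr a, .inr b => t a b
    | _, _ => False
  iseqv :=
    { refl := by
        rintro (a | b)
        · exact s.refl a
        · exact t.refl b
      symm := by
        rintro (a | a) (b | b) h
        · exact s.symm h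
        · exact h
        · exact h
        · exact t.symm h
      trans := by
        rintro (a | a) (b | b) (c | c) h h'
        · exact s.trans h h'
        · exact h'
        · exact h.elim
        · exact h
        · exact h
        · exact h.elim
        · exact h'
        · exact t.trans h h' }

@[simp] theorem sumSetoid_inl_inl {α β : Type} (s : Setoid α) (t : Setoid β) (a b : α) :
    sumSetoid s t (.inl a) (.inl b) ↔ s a b := Iff.rfl

@[simp] theorem sumSetoid_inr_inr {α β : Type} (s : Setoid α) (t : Setoid β) (a b : β) :
    sumSetoid s t (.inr a) (.inr b) ↔ t a b := Iff.rfl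

@[simp] theorem sumSetoid_inl_inr {α β : Type} (s : Setoid α) (t : Setoid β) (a : α) (b : β) :
    ¬ sumSetoid s t (.inl a) (.inr b) := id

@[simp] theorem sumSetoid_inr_inl {α β : Type} (s : Setoid α) (t : Setoid β) (a : α) (b : β) :
    ¬ sumSetoid s t (.inr b) (.inl a) := id

/-- Disjoint union of graphs. -/
def union (Γ Γ' : FGraph) : FGraph where
  HalfEdge := Γ.HalfEdge ⊕ Γ'.HalfEdge
  finite := inferInstance
  mate := Sum.map Γ.mate Γ'.mate
  mate_mate := by rintro (h | h) <;> simp [mate_mate]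
  mate_ne := by rintro (h | h) <;> simp [mate_ne]
  vert := sumSetoid Γ.vert Γ'.vert
  ext := {h | Sum.elim (· ∈ Γ.ext) (· ∈ Γ'.ext) h}
  ext_univalent := by
    rintro (x | x) hx (h | h) hxh
    · simp only [sumSetoid_inl_inl] at hxh
      rw [Γ.ext_univalent x hx h hxh]
    · simp at hxh
    · simp at hxh
    · simp only [sumSetoid_inr_inr] at hxh
      rw [Γ'.ext_univalent x hx h hxh]

/-- The empty graph. -/
def empty : FGraph where
  HalfEdge := Empty
  finite := inferInstance
  mate := id
  mate_mate := fun h => h.elim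
  mate_ne := fun h => h.elim
  vert := ⊥
  ext := ∅
  ext_univalent := fun h => h.elim

/-- Isomorphism as an equivalence relation on graphs. -/
def isoSetoid : Setoid FGraph where
  r Γ Γ' := Nonempty (Iso Γ Γ')
  iseqv :=
    { refl := fun Γ => ⟨Iso.refl Γ⟩
      symm := fun ⟨e⟩ => ⟨e.symm⟩
      trans := fun ⟨e⟩ ⟨f⟩ => ⟨e.trans f⟩ }

end FGraph

/-- Isomorphism classes of graphs. -/
def GraphClass : Type 1 := Quotient FGraph.isoSetoid

namespace FGraph

/-- The isomorphism class of a graph. -/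
def cls (Γ : FGraph) : GraphClass := Quotient.mk isoSetoid Γ

theorem cls_eq_of_iso {Γ Γ' : FGraph} (e : Iso Γ Γ') : Γ.cls = Γ'.cls :=
  Quotient.sound (s := isoSetoid) ⟨e⟩

end FGraph

namespace GraphClass

open FGraph

/-- Isomorphism classes of graphs form a commutative monoid under disjoint union. -/
instance : CommMonoid GraphClass where
  mul := Quotient.map₂ FGraph.union (by
    rintro Γ₁ Γ₁' ⟨e⟩ Γ₂ Γ₂' ⟨f⟩
    refine ⟨⟨Equiv.sumCongr e.toEquiv f.toEquiv, ?_, ?_, ?_⟩⟩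
    · rintro (h | h)
      · exact congrArg Sum.inl (e.map_mate h)
      · exact congrArg Sum.inr (f.map_mate h)
    · rintro (a | a) (b | b)
      · exact e.map_vert a b
      · exact Iff.rfl
      · exact Iff.rfl
      · exact f.map_vert a b
    · rintro (h | h)
      · exact e.map_ext h
      · exact f.map_ext h)
  one := FGraph.empty.cls
  mul_assoc := by
    rintro ⟨A⟩ ⟨B⟩ ⟨C⟩
    refine FGraph.cls_eq_of_iso ⟨Equiv.sumAssoc _ _ _, ?_, ?_, ?_⟩
    · rintro ((h | h) | h) <;> rfl
    · rintro ((a | a) | a) ((b | b) | b) <;> exact Iff.rfl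
    · rintro ((h | h) | h) <;> exact Iff.rfl
  one_mul := by
    rintro ⟨A⟩
    refine FGraph.cls_eq_of_iso ⟨Equiv.emptySum Empty _, ?_, ?_, ?_⟩
    · rintro (h | h)
      · exact h.elim
      · rfl
    · rintro (a | a) (b | b)
      · exact a.elim
      · exact a.elim
      · exact b.elim
      · exact Iff.rfl
    · rintro (h | h)
      · exact h.elim
      · exact Iff.rfl
  mul_one := by
    rintro ⟨A⟩
    refine FGraph.cls_eq_of_iso ⟨Equiv.sumEmpty _ Empty, ?_, ?_, ?_⟩
    · rintro (h | h)
      · rfl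
      · exact h.elim
    · rintro (a | a) (b | b)
      · exact Iff.rfl
      · exact b.elim
      · exact a.elim
      · exact a.elim
    · rintro (h | h)
      · exact Iff.rfl
      · exact h.elim
  mul_comm := by
    rintro ⟨A⟩ ⟨B⟩
    refine FGraph.cls_eq_of_iso ⟨Equiv.sumComm _ _, ?_, ?_, ?_⟩
    · rintro (h | h) <;> rfl
    · rintro (a | a) (b | b) <;> exact Iff.rfl
    · rintro (h | h) <;> exact Iff.rfl

theorem cls_union (Γ Γ' : FGraph) : (Γ.union Γ').cls = Γ.cls * Γ'.cls := rfl

theorem cls_empty : FGraph.empty.cls = 1 := rfl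

/-- The order of the automorphism group of any representative. -/
noncomputable def autCard : GraphClass → ℕ :=
  Quotient.lift FGraph.autCard fun _ _ ⟨e⟩ => FGraph.autCard_congr e

theorem autCard_cls (Γ : FGraph) : Γ.cls.autCard = Γ.autCard := rfl

theorem autCard_ne_zero (c : GraphClass) : c.autCard ≠ 0 := by
  obtain ⟨Γ⟩ := c
  exact FGraph.autCard_ne_zero Γ

end GraphClass

namespace FGraph

/-! ### Subgraphs and contractions -/

/-- A subgraph: a set of internal edges, given as the set of half-edges lying on these edges. -/
@[ext] structure Subgraph (Γ : FGraph) where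
  carrier : Set Γ.HalfEdge
  mate_mem : ∀ h ∈ carrier, Γ.mate h ∈ carrier
  internal : ∀ h ∈ carrier, Γ.IsInternal h

/-- Nontrivial subgraphs: neither the empty set nor the whole set of internal edges. -/
def Subgraph.Nontrivial {Γ : FGraph} (γ : Γ.Subgraph) : Prop :=
  γ.carrier.Nonempty ∧ ∃ h, Γ.IsInternal h ∧ h ∉ γ.carrier

instance (Γ : FGraph) : Finite Γ.Subgraph :=
  Finite.of_injective Subgraph.carrier fun _ _ => Subgraph.ext

noncomputable instance (Γ : FGraph) : Fintype {γ : Γ.Subgraph // γ.Nontrivial} :=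
  Fintype.ofFinite _

/-- The relation generating the vertices of the contraction by `γ`:
to lie at the same vertex, or to be the two ends of an edge of `γ`. -/
def Subgraph.Merge {Γ : FGraph} (γ : Γ.Subgraph) (a b : Γ.HalfEdge) : Prop :=
  Γ.vert a b ∨ (a ∈ γ.carrier ∧ b = Γ.mate a)

/-- The graph `Γ/γ`: the edges of `γ` are removed and the vertices which they connect are merged.
A vertex left without half-edges disappears. -/
def contract (Γ : FGraph) (γ : Γ.Subgraph) : FGraph where
  HalfEdge := {h : Γ.HalfEdge // h ∉ γ.carrier}
  finite := inferInstance
  mate h := ⟨Γ.mate h.1, fun hm => h.2 (by simpa [Γ.mate_mate] using γ.mate_mem _ hm)⟩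
  mate_mate h := Subtype.ext (Γ.mate_mate h.1)
  mate_ne h hh := Γ.mate_ne h.1 (congrArg Subtype.val hh)
  vert := (Relation.EqvGen.setoid γ.Merge).comap Subtype.val
  ext := {h | h.1 ∈ Γ.ext}
  ext_univalent := by
    intro x hx h hxh
    have key : ∀ a b, Relation.EqvGen γ.Merge a b → (a = x.1 ↔ b = x.1) := by
      intro a b hab
      induction hab with
      | rel a b hab =>
        rcases hab with hv | ⟨ha, rfl⟩
        · constructor
          · rintro rfl
            exact Γ.ext_univalent _ hx _ hv
          · rintro rfl
            exact Γ.ext_univalent _ hx _ (Γ.vert.symm hv)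
        · constructor
          · rintro rfl
            exact absurd hx (γ.internal _ ha).1
          · intro h'
            exact absurd (h' ▸ hx) (γ.internal _ ha).2
      | refl a => exact Iff.rfl
      | symm a b _ ih => exact ih.symm
      | trans a b c _ _ ih₁ ih₂ => exact ih₁.trans ih₂
    exact Subtype.ext ((key _ _ hxh).1 rfl)

/-- The set of half-edges of `Γ` lying at a vertex which meets an edge of `γ`. -/
def Subgraph.support {Γ : FGraph} (γ : Γ.Subgraph) : Set Γ.HalfEdge :=
  {h | ∃ s ∈ γ.carrier, Γ.vert s h}

theorem Subgraph.carrier_subset_support {Γ : FGraph} (γ : Γ.Subgraph) {h : Γ.HalfEdge}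
    (hh : h ∈ γ.carrier) : h ∈ γ.support := ⟨h, hh, Γ.vert.refl h⟩

open Classical in
/-- A subgraph viewed as a graph: its half-edges are those in the support (left summand), together
with one new half-edge for each half-edge of the support not belonging to `γ` (right summand).
The edges are those of `γ` and the pairs formed by an old half-edge outside `γ` and its new partner;
each new half-edge forms an external vertex. -/
noncomputable def Subgraph.toGraph {Γ : FGraph} (γ : Γ.Subgraph) : FGraph where
  HalfEdge := {h : Γ.HalfEdge // h ∈ γ.support} ⊕
    {h : Γ.HalfEdge // h ∈ γ.support ∧ h ∉ γ.carrier}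
  finite := inferInstance
  mate := Sum.elim
    (fun h => if hh : h.1 ∈ γ.carrier
      then .inl ⟨Γ.mate h.1, γ.carrier_subset_support (γ.mate_mem _ hh)⟩
      else .inr ⟨h.1, h.2, hh⟩)
    (fun h => .inl ⟨h.1, h.2.1⟩)
  mate_mate := by
    rintro (h | h)
    · by_cases hh : h.1 ∈ γ.carrier
      · simp [hh, γ.mate_mem _ hh, Γ.mate_mate]
      · simp [hh]
    · simp [h.2.2]
  mate_ne := by
    rintro (h | h)
    · by_cases hh : h.1 ∈ γ.carrier
      · intro he
        simp only [Sum.elim_inl, hh, dite_true, Sum.inl.injEq] at he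
        exact Γ.mate_ne _ (congrArg Subtype.val he)
      · simp [hh]
    · simp
  vert := sumSetoid (Γ.vert.comap Subtype.val) ⊥
  ext := Set.range Sum.inr
  ext_univalent := by
    rintro _ ⟨x, rfl⟩ (h | h) hxh
    · simp at hxh
    · simp only [sumSetoid_inr_inr] at hxh
      rw [show x = h from hxh]

/-! ### Connected components -/

/-- The type of connected components. -/
def Component (Γ : FGraph) : Type := Quotient Γ.conn

instance (Γ : FGraph) : Finite Γ.Component := inferInstanceAs (Finite (Quotient Γ.conn))

noncomputable instance (Γ : FGraph) : Fintype Γ.Component := Fintype.ofFinite _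

/-- The component of a half-edge. -/
def component (Γ : FGraph) (h : Γ.HalfEdge) : Γ.Component := Quotient.mk Γ.conn h

theorem Component.exists_rep {Γ : FGraph} (c : Γ.Component) : ∃ h, Γ.component h = c :=
  Quotient.exists_rep c

theorem component_mate (Γ : FGraph) (h : Γ.HalfEdge) :
    Γ.component (Γ.mate h) = Γ.component h :=
  (Quotient.sound (s := Γ.conn) (.rel _ _ (Or.inr rfl))).symm

/-- A connected component, viewed as a graph. -/
def Component.toGraph {Γ : FGraph} (c : Γ.Component) : FGraph where
  HalfEdge := {h : Γ.HalfEdge // Γ.component h = c}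
  finite := inferInstance
  mate h := ⟨Γ.mate h.1, (Γ.component_mate h.1).trans h.2⟩
  mate_mate h := Subtype.ext (Γ.mate_mate h.1)
  mate_ne h hh := Γ.mate_ne h.1 (congrArg Subtype.val hh)
  vert := Γ.vert.comap Subtype.val
  ext := {h | h.1 ∈ Γ.ext}
  ext_univalent := fun x hx h hxh => Subtype.ext (Γ.ext_univalent x.1 hx h.1 hxh)

/-! ### Invariance under isomorphisms -/

theorem eqvGen_map_iff {α β : Type} {r : α → α → Prop} {s : β → β → Prop} (f : α → β)
    (hf : Function.Injective f) (hrs : ∀ a b, r a b ↔ s (f a) (f b))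
    (h₁ : ∀ a y, s (f a) y → y ∈ Set.range f) (h₂ : ∀ a y, s y (f a) → y ∈ Set.range f)
    (a b : α) : Relation.EqvGen r a b ↔ Relation.EqvGen s (f a) (f b) := by
  constructor
  · intro h
    induction h with
    | rel a b h => exact .rel _ _ ((hrs a b).1 h)
    | refl a => exact .refl _
    | symm a b _ ih => exact .symm _ _ ih
    | trans a b c _ _ ih₁ ih₂ => exact .trans _ _ _ ih₁ ih₂
  · have key : ∀ x y, Relation.EqvGen s x y →
        (∀ a, x = f a → ∃ b, y = f b ∧ Relation.EqvGen r a b) ∧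
        (∀ b, y = f b → ∃ a, x = f a ∧ Relation.EqvGen r a b) := by
      intro x y h
      induction h with
      | rel x y h =>
        constructor
        · rintro a rfl
          obtain ⟨b, rfl⟩ := h₁ a y h
          exact ⟨b, rfl, .rel _ _ ((hrs a b).2 h)⟩
        · rintro b rfl
          obtain ⟨a, rfl⟩ := h₂ b x h
          exact ⟨a, rfl, .rel _ _ ((hrs a b).2 h)⟩
      | refl x => exact ⟨fun a ha => ⟨a, ha, .refl _⟩, fun a ha => ⟨a, ha, .refl _⟩⟩
      | symm x y _ ih =>
        refine ⟨fun a ha => ?_, fun a ha => ?_⟩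
        · obtain ⟨b, hb, h⟩ := ih.2 a ha
          exact ⟨b, hb, .symm _ _ h⟩
        · obtain ⟨b, hb, h⟩ := ih.1 a ha
          exact ⟨b, hb, .symm _ _ h⟩
      | trans x y z _ _ ih₁ ih₂ =>
        refine ⟨fun a ha => ?_, fun c hc => ?_⟩
        · obtain ⟨b, hb, h⟩ := ih₁.1 a ha
          obtain ⟨c, hc, h'⟩ := ih₂.1 b hb
          exact ⟨c, hc, .trans _ _ _ h h'⟩
        · obtain ⟨b, hb, h⟩ := ih₂.2 c hc
          obtain ⟨a, ha, h'⟩ := ih₁.2 b hb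
          exact ⟨a, ha, .trans _ _ _ h' h⟩
    intro h
    obtain ⟨b', hb', h'⟩ := (key _ _ h).1 a rfl
    rwa [hf hb']

/-- The image of a subgraph under an isomorphism. -/
def Subgraph.map {Γ Γ' : FGraph} (e : Iso Γ Γ') (γ : Γ.Subgraph) : Γ'.Subgraph where
  carrier := {h | e.toEquiv.symm h ∈ γ.carrier}
  mate_mem h hh := by
    have := γ.mate_mem _ hh
    have h2 := e.symm.map_mate h
    simp only [Iso.symm] at h2
    simpa [h2] using this
  internal h hh := by
    have h2 := e.map_mate (e.toEquiv.symm h)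
    have h3 := γ.internal _ hh
    simp only [IsInternal, e.map_ext, h2, Equiv.apply_symm_apply] at h3
    exact h3

theorem IsInternal.iff_map {Γ Γ' : FGraph} (e : Iso Γ Γ') (h : Γ.HalfEdge) :
    Γ.IsInternal h ↔ Γ'.IsInternal (e.toEquiv h) := by
  simp only [IsInternal, e.map_ext, e.map_mate]

theorem Subgraph.mem_map {Γ Γ' : FGraph} (e : Iso Γ Γ') (γ : Γ.Subgraph) (h : Γ.HalfEdge) :
    e.toEquiv h ∈ (γ.map e).carrier ↔ h ∈ γ.carrier := by
  simp [Subgraph.map]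

theorem Subgraph.nontrivial_map {Γ Γ' : FGraph} (e : Iso Γ Γ') (γ : Γ.Subgraph)
    (hγ : γ.Nontrivial) : (γ.map e).Nontrivial := by
  obtain ⟨⟨s, hs⟩, h, hi, hh⟩ := hγ
  exact ⟨⟨e.toEquiv s, (γ.mem_map e s).2 hs⟩, e.toEquiv h, (IsInternal.iff_map e h).1 hi,
    fun h' => hh ((γ.mem_map e h).1 h')⟩

theorem Subgraph.mem_support_map {Γ Γ' : FGraph} (e : Iso Γ Γ') (γ : Γ.Subgraph)
    (h : Γ.HalfEdge) : e.toEquiv h ∈ (γ.map e).support ↔ h ∈ γ.support := by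
  constructor
  · rintro ⟨s, hs, hv⟩
    refine ⟨e.toEquiv.symm s, hs, ?_⟩
    rwa [e.map_vert, Equiv.apply_symm_apply]
  · rintro ⟨s, hs, hv⟩
    exact ⟨e.toEquiv s, (γ.mem_map e s).2 hs, (e.map_vert _ _).1 hv⟩

/-- Isomorphisms transport nontrivial subgraphs. -/
def subgraphEquiv {Γ Γ' : FGraph} (e : Iso Γ Γ') :
    {γ : Γ.Subgraph // γ.Nontrivial} ≃ {γ : Γ'.Subgraph // γ.Nontrivial} where
  toFun γ := ⟨γ.1.map e, γ.1.nontrivial_map e γ.2⟩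
  invFun γ := ⟨γ.1.map e.symm, γ.1.nontrivial_map e.symm γ.2⟩
  left_inv γ := by
    apply Subtype.ext
    apply Subgraph.ext
    ext h
    simp [Subgraph.map, Iso.symm]
  right_inv γ := by
    apply Subtype.ext
    apply Subgraph.ext
    ext h
    simp [Subgraph.map, Iso.symm]

/-- Isomorphisms are compatible with contractions. -/
def contractIso {Γ Γ' : FGraph} (e : Iso Γ Γ') (γ : Γ.Subgraph) :
    Iso (Γ.contract γ) (Γ'.contract (γ.map e)) where
  toEquiv := e.toEquiv.subtypeEquiv fun h => not_congr (γ.mem_map e h).symm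
  map_mate h := Subtype.ext (e.map_mate h.1)
  map_vert a b := by
    refine eqvGen_map_iff (r := γ.Merge) (s := (γ.map e).Merge) e.toEquiv e.toEquiv.injective
      ?_ (fun _ y _ => ⟨e.toEquiv.symm y, by simp⟩)
      (fun _ y _ => ⟨e.toEquiv.symm y, by simp⟩) a.1 b.1
    intro a b
    simp only [Subgraph.Merge, Subgraph.mem_map, ← e.map_mate, e.toEquiv.injective.eq_iff,
      ← e.map_vert]
  map_ext h := e.map_ext h.1

/-- Isomorphisms are compatible with viewing subgraphs as graphs. -/
noncomputable def subgraphIso {Γ Γ' : FGraph} (e : Iso Γ Γ') (γ : Γ.Subgraph) :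
    Iso γ.toGraph (γ.map e).toGraph where
  toEquiv := Equiv.sumCongr
    (e.toEquiv.subtypeEquiv fun h => (γ.mem_support_map e h).symm)
    (e.toEquiv.subtypeEquiv fun h =>
      and_congr (γ.mem_support_map e h).symm (not_congr (γ.mem_map e h).symm))
  map_mate := by
    rintro (h | h)
    · by_cases hh : h.1 ∈ γ.carrier
      · have hh' : e.toEquiv h.1 ∈ (γ.map e).carrier := (γ.mem_map e h.1).2 hh
        have h1 : γ.toGraph.mate (.inl h) =
            .inl ⟨Γ.mate h.1, γ.carrier_subset_support (γ.mate_mem _ hh)⟩ := dif_pos hh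
        refine (congrArg _ h1).trans (Eq.trans ?_ (dif_pos hh').symm)
        exact congrArg Sum.inl (Subtype.ext (e.map_mate h.1))
      · have hh' : e.toEquiv h.1 ∉ (γ.map e).carrier := fun h' => hh ((γ.mem_map e h.1).1 h')
        have h1 : γ.toGraph.mate (.inl h) = .inr ⟨h.1, h.2, hh⟩ := dif_neg hh
        refine (congrArg _ h1).trans (Eq.trans ?_ (dif_neg hh').symm)
        rfl
    · rfl
  map_vert := by
    rintro (a | a) (b | b)
    · exact e.map_vert a.1 b.1
    · exact Iff.rfl
    · exact Iff.rfl
    · exact (Equiv.injective _).eq_iff.symm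
  map_ext := by
    rintro (h | h)
    · exact iff_of_false (by rintro ⟨_, h⟩; cases h) (by rintro ⟨_, h⟩; cases h)
    · exact iff_of_true ⟨h, rfl⟩ ⟨_, rfl⟩

/-- Restriction to connected components of an injective map of graphs whose image is a union
of components. -/
noncomputable def componentIso {Γ Γ' : FGraph} (f : Γ.HalfEdge → Γ'.HalfEdge)
    (hf : Function.Injective f)
    (hmate : ∀ h, f (Γ.mate h) = Γ'.mate (f h))
    (hvert : ∀ a b, Γ.vert a b ↔ Γ'.vert (f a) (f b))
    (hext : ∀ h, h ∈ Γ.ext ↔ f h ∈ Γ'.ext) (c : Γ.Component) (c' : Γ'.Component)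
    (hc : ∀ h, Γ.component h = c ↔ Γ'.component (f h) = c')
    (hc' : ∀ y, Γ'.component y = c' → y ∈ Set.range f) : Iso c.toGraph c'.toGraph where
  toEquiv := Equiv.ofBijective (fun h => ⟨f h.1, (hc h.1).1 h.2⟩)
    ⟨fun a b h => Subtype.ext (hf (congrArg Subtype.val h)), by
      rintro ⟨y, hy⟩
      obtain ⟨x, rfl⟩ := hc' y hy
      exact ⟨⟨x, (hc x).2 hy⟩, rfl⟩⟩
  map_mate h := Subtype.ext (hmate h.1)
  map_vert a b := hvert a.1 b.1
  map_ext h := hext h.1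

theorem Adj.iff_map {Γ Γ' : FGraph} (e : Iso Γ Γ') (a b : Γ.HalfEdge) :
    Γ.Adj a b ↔ Γ'.Adj (e.toEquiv a) (e.toEquiv b) := by
  simp only [Adj, ← e.map_mate, e.toEquiv.injective.eq_iff, ← e.map_vert]

/-- Isomorphisms transport connected components. -/
def componentEquiv {Γ Γ' : FGraph} (e : Iso Γ Γ') : Γ.Component ≃ Γ'.Component :=
  Quotient.congr e.toEquiv fun a b =>
    eqvGen_map_iff e.toEquiv e.toEquiv.injective (Adj.iff_map e)
      (fun _ y _ => ⟨e.toEquiv.symm y, by simp⟩)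
      (fun _ y _ => ⟨e.toEquiv.symm y, by simp⟩) a b

theorem componentEquiv_component {Γ Γ' : FGraph} (e : Iso Γ Γ') (h : Γ.HalfEdge) :
    componentEquiv e (Γ.component h) = Γ'.component (e.toEquiv h) := rfl

theorem adj_union_inl_inl (Γ Γ' : FGraph) (a b : Γ.HalfEdge) :
    (Γ.union Γ').Adj (.inl a) (.inl b) ↔ Γ.Adj a b :=
  or_congr Iff.rfl (Sum.inl_injective (α := Γ.HalfEdge) (β := Γ'.HalfEdge)).eq_iff

theorem adj_union_inr_inr (Γ Γ' : FGraph) (a b : Γ'.HalfEdge) :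
    (Γ.union Γ').Adj (.inr a) (.inr b) ↔ Γ'.Adj a b :=
  or_congr Iff.rfl (Sum.inr_injective (α := Γ.HalfEdge) (β := Γ'.HalfEdge)).eq_iff

theorem not_adj_union_inl_inr (Γ Γ' : FGraph) (a : Γ.HalfEdge) (b : Γ'.HalfEdge) :
    ¬ (Γ.union Γ').Adj (.inl a) (.inr b) := by
  rintro (h | h)
  · exact h
  · cases h

theorem not_adj_union_inr_inl (Γ Γ' : FGraph) (a : Γ.HalfEdge) (b : Γ'.HalfEdge) :
    ¬ (Γ.union Γ').Adj (.inr b) (.inl a) := by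
  rintro (h | h)
  · exact h
  · cases h

theorem component_union_inl_iff (Γ Γ' : FGraph) (a b : Γ.HalfEdge) :
    Γ.component a = Γ.component b ↔
      (Γ.union Γ').component (.inl a) = (Γ.union Γ').component (.inl b) := by
  have h := eqvGen_map_iff (r := Γ.Adj) (s := (Γ.union Γ').Adj)
    (Sum.inl : Γ.HalfEdge → Γ.HalfEdge ⊕ Γ'.HalfEdge) Sum.inl_injective
    (fun a b => (adj_union_inl_inl Γ Γ' a b).symm)
    (fun a y h => by
      rcases y with y | y
      · exact ⟨y, rfl⟩
      · exact absurd h (not_adj_union_inl_inr Γ Γ' a y))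
    (fun a y h => by
      rcases y with y | y
      · exact ⟨y, rfl⟩
      · exact absurd h (not_adj_union_inr_inl Γ Γ' a y)) a b
  exact (Quotient.eq (r := Γ.conn)).trans (h.trans (Quotient.eq (r := (Γ.union Γ').conn)).symm)

theorem component_union_inr_iff (Γ Γ' : FGraph) (a b : Γ'.HalfEdge) :
    Γ'.component a = Γ'.component b ↔
      (Γ.union Γ').component (.inr a) = (Γ.union Γ').component (.inr b) := by
  have h := eqvGen_map_iff (r := Γ'.Adj) (s := (Γ.union Γ').Adj)
    (Sum.inr : Γ'.HalfEdge → Γ.HalfEdge ⊕ Γ'.HalfEdge) Sum.inr_injective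
    (fun a b => (adj_union_inr_inr Γ Γ' a b).symm)
    (fun a y h => by
      rcases y with y | y
      · exact absurd h (not_adj_union_inr_inl Γ Γ' y a)
      · exact ⟨y, rfl⟩)
    (fun a y h => by
      rcases y with y | y
      · exact absurd h (not_adj_union_inl_inr Γ Γ' y a)
      · exact ⟨y, rfl⟩) a b
  exact (Quotient.eq (r := Γ'.conn)).trans (h.trans (Quotient.eq (r := (Γ.union Γ').conn)).symm)

theorem component_union_inl_ne_inr (Γ Γ' : FGraph) (a : Γ.HalfEdge) (b : Γ'.HalfEdge) :
    (Γ.union Γ').component (.inl a) ≠ (Γ.union Γ').component (.inr b) := by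
  intro h
  have h' : Relation.EqvGen (Γ.union Γ').Adj (.inl a) (.inr b) := Quotient.exact h
  have key : ∀ x y, Relation.EqvGen (Γ.union Γ').Adj x y → (x.isLeft ↔ y.isLeft) := by
    intro x y hxy
    induction hxy with
    | rel x y hxy =>
      rcases x with x | x <;> rcases y with y | y
      · exact Iff.rfl
      · exact absurd hxy (not_adj_union_inl_inr Γ Γ' x y)
      · exact absurd hxy (not_adj_union_inr_inl Γ Γ' y x)
      · exact Iff.rfl
    | refl x => exact Iff.rfl
    | symm x y _ ih => exact ih.symm
    | trans x y z _ _ ih₁ ih₂ => exact ih₁.trans ih₂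
  simpa using key _ _ h'

/-- The components of a disjoint union. -/
noncomputable def componentUnionEquiv (Γ Γ' : FGraph) :
    Γ.Component ⊕ Γ'.Component ≃ (Γ.union Γ').Component :=
  Equiv.ofBijective
    (Sum.elim
      (Quotient.lift (fun a => (Γ.union Γ').component (.inl a)) fun a b h =>
        (component_union_inl_iff Γ Γ' a b).1 (Quotient.sound h))
      (Quotient.lift (fun a => (Γ.union Γ').component (.inr a)) fun a b h =>
        (component_union_inr_iff Γ Γ' a b).1 (Quotient.sound h)))
    (by
      constructor
      · rintro (a | a) (b | b) h <;> obtain ⟨a, rfl⟩ := a.exists_rep <;>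
          obtain ⟨b, rfl⟩ := b.exists_rep
        · exact congrArg Sum.inl ((component_union_inl_iff Γ Γ' a b).2 h)
        · exact absurd h (component_union_inl_ne_inr Γ Γ' a b)
        · exact absurd h.symm (component_union_inl_ne_inr Γ Γ' b a)
        · exact congrArg Sum.inr ((component_union_inr_iff Γ Γ' a b).2 h)
      · rintro ⟨a | a⟩
        · exact ⟨.inl (Γ.component a), rfl⟩
        · exact ⟨.inr (Γ'.component a), rfl⟩)

theorem cls_component_union_inl (Γ Γ' : FGraph) (c : Γ.Component) :
    (componentUnionEquiv Γ Γ' (.inl c)).toGraph.cls = c.toGraph.cls := by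
  obtain ⟨a, rfl⟩ := c.exists_rep
  refine (cls_eq_of_iso (componentIso (Γ' := Γ.union Γ') Sum.inl Sum.inl_injective
    (fun _ => rfl) (fun _ _ => Iff.rfl) (fun _ => Iff.rfl) _ _
    (fun h => component_union_inl_iff Γ Γ' h a) ?_)).symm
  · rintro (y | y) hy
    · exact ⟨y, rfl⟩
    · exact absurd hy.symm (component_union_inl_ne_inr Γ Γ' a y)

theorem cls_component_union_inr (Γ Γ' : FGraph) (c : Γ'.Component) :
    (componentUnionEquiv Γ Γ' (.inr c)).toGraph.cls = c.toGraph.cls := by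
  obtain ⟨a, rfl⟩ := c.exists_rep
  refine (cls_eq_of_iso (componentIso (Γ' := Γ.union Γ') Sum.inr Sum.inr_injective
    (fun _ => rfl) (fun _ _ => Iff.rfl) (fun _ => Iff.rfl) _ _
    (fun h => component_union_inr_iff Γ Γ' h a) ?_)).symm
  · rintro (y | y) hy
    · exact absurd hy (component_union_inl_ne_inr Γ Γ' y a)
    · exact ⟨y, rfl⟩

theorem cls_componentEquiv {Γ Γ' : FGraph} (e : Iso Γ Γ') (c : Γ.Component) :
    (componentEquiv e c).toGraph.cls = c.toGraph.cls := by
  obtain ⟨a, rfl⟩ := c.exists_rep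
  refine (cls_eq_of_iso (componentIso e.toEquiv e.toEquiv.injective e.map_mate e.map_vert
    e.map_ext _ _ (fun h => ?_) (fun y _ => ⟨e.toEquiv.symm y, by simp⟩))).symm
  exact (componentEquiv e).injective.eq_iff.symm

end FGraph

/-! ### The Hopf algebra of graphs and its dual -/

section Hopf

open FGraph

/-- The algebra freely spanned by isomorphism classes of graphs; the product is disjoint union. -/
abbrev GraphAlgebra (K : Type*) [Field K] : Type _ := MonoidAlgebra K GraphClass

/-- A graph as an element of the algebra of graphs. -/
noncomputable def GraphAlgebra.of (K : Type*) [Field K] (c : GraphClass) : GraphAlgebra K :=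
  MonoidAlgebra.of K GraphClass c

variable (K : Type*) [Field K]

/-- The Connes-Kreimer formula `1 ⊗ Γ + Γ ⊗ 1 + ∑ γ ⊗ Γ/γ`, the sum running over all nontrivial
subgraphs; it is the coproduct of `Γ` when `Γ` is connected. -/
noncomputable def FGraph.coprodFormula (Γ : FGraph) : GraphAlgebra K ⊗[K] GraphAlgebra K :=
  1 ⊗ₜ GraphAlgebra.of K Γ.cls + GraphAlgebra.of K Γ.cls ⊗ₜ 1 +
    ∑ γ : {γ : Γ.Subgraph // γ.Nontrivial},
      GraphAlgebra.of K γ.1.toGraph.cls ⊗ₜ GraphAlgebra.of K (Γ.contract γ.1).cls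

theorem FGraph.coprodFormula_congr {Γ Γ' : FGraph} (h : Γ.cls = Γ'.cls) :
    Γ.coprodFormula K = Γ'.coprodFormula K := by
  obtain ⟨e⟩ : Nonempty (Iso Γ Γ') := Quotient.exact (s := isoSetoid) h
  unfold FGraph.coprodFormula
  rw [h]
  congr 1
  refine Fintype.sum_equiv (subgraphEquiv e) _ _ fun γ => ?_
  rw [cls_eq_of_iso (subgraphIso e γ.1), cls_eq_of_iso (contractIso e γ.1)]
  rfl

/-- The coproduct of an arbitrary graph: the product of the coproducts of its components. -/
noncomputable def FGraph.coprod (Γ : FGraph) : GraphAlgebra K ⊗[K] GraphAlgebra K :=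
  ∏ c : Γ.Component, c.toGraph.coprodFormula K

/-- The coproduct `∇` of the algebra of graphs. -/
noncomputable def nabla : GraphAlgebra K →ₐ[K] GraphAlgebra K ⊗[K] GraphAlgebra K :=
  MonoidAlgebra.lift K (GraphAlgebra K ⊗[K] GraphAlgebra K) GraphClass
    { toFun := Quotient.lift (FGraph.coprod K) (by
        rintro Γ Γ' ⟨e⟩
        exact Fintype.prod_equiv (componentEquiv e) _ _ fun c =>
          (FGraph.coprodFormula_congr K (cls_componentEquiv e c)).symm)
      map_one' := by
        have : IsEmpty FGraph.empty.Component :=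
          ⟨fun c => Quotient.inductionOn c fun h : Empty => h.elim⟩
        exact Fintype.prod_empty _
      map_mul' := by
        rintro ⟨Γ⟩ ⟨Γ'⟩
        change FGraph.coprod K (Γ.union Γ') = FGraph.coprod K Γ * FGraph.coprod K Γ'
        unfold FGraph.coprod
        rw [← Fintype.prod_equiv (componentUnionEquiv Γ Γ') _ _ fun c => rfl,
          Fintype.prod_sum_type]
        congr 1
        · exact Finset.prod_congr rfl fun c _ =>
            FGraph.coprodFormula_congr K (cls_component_union_inl Γ Γ' c)
        · exact Finset.prod_congr rfl fun c _ =>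
            FGraph.coprodFormula_congr K (cls_component_union_inr Γ Γ' c) }

/-- On connected graphs, `∇` is given by the Connes-Kreimer formula. -/
theorem nabla_of_connected (Γ : FGraph) (hΓ : Γ.Connected) :
    nabla K (GraphAlgebra.of K Γ.cls) = Γ.coprodFormula K := by
  have h1 : nabla K (GraphAlgebra.of K Γ.cls) = Γ.coprod K := by
    rw [nabla, GraphAlgebra.of, MonoidAlgebra.lift_of]
    rfl
  obtain ⟨⟨a⟩, hconn⟩ := hΓ
  have hall : ∀ c : Γ.Component, c = Γ.component a := by
    rintro ⟨b⟩
    exact Quotient.sound (hconn b a)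
  rw [h1, FGraph.coprod]
  have : Unique Γ.Component := ⟨⟨Γ.component a⟩, hall⟩
  rw [Fintype.prod_unique]
  refine FGraph.coprodFormula_congr K (cls_eq_of_iso
    ⟨Equiv.subtypeUnivEquiv fun h => (hall _).trans (hall _).symm, fun _ => rfl,
      fun _ _ => Iff.rfl, fun _ => Iff.rfl⟩)

/-- Formal infinite linear combinations of isomorphism classes of graphs. -/
abbrev GraphSeries : Type _ := GraphClass → K

open Classical in
/-- A graph as a formal linear combination. -/
noncomputable def GraphSeries.of (Γ : FGraph) : GraphSeries K := Pi.single Γ.cls 1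

variable [CharZero K]

/-- The canonical isomorphism onto the dual of the algebra of graphs, `Γ ↦ |Aut Γ| ⟨Γ, -⟩`, where
`⟨-, -⟩` is the bilinear form for which isomorphism classes of graphs are orthonormal. -/
noncomputable def dualIso : GraphSeries K ≃ₗ[K] Module.Dual K (GraphAlgebra K) :=
  (LinearEquiv.piCongrRight fun c : GraphClass =>
    LinearEquiv.smulOfNeZero K K (c.autCard : K) (Nat.cast_ne_zero.2 c.autCard_ne_zero)).trans
    ((MonoidAlgebra.basis GraphClass K).constr K)

/-- The defining property of `dualIso`. -/
theorem dualIso_apply (x : GraphSeries K) (c : GraphClass) :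
    dualIso K x (GraphAlgebra.of K c) = (c.autCard : K) * x c := by
  have h : GraphAlgebra.of K c = MonoidAlgebra.basis GraphClass K c := by
    simp [GraphAlgebra.of]
  rw [h, dualIso, LinearEquiv.trans_apply, Module.Basis.constr_basis]
  simp

/-- The product `⋆` on formal combinations of graphs, dual to the coproduct `∇`. -/
noncomputable def starProd (x y : GraphSeries K) : GraphSeries K :=
  (dualIso K).symm
    (LinearMap.mul' K K ∘ₗ TensorProduct.map (dualIso K x) (dualIso K y) ∘ₗ
      (nabla K).toLinearMap)

/-- The commutator with respect to `⋆`. -/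
noncomputable def starBracket (x y : GraphSeries K) : GraphSeries K :=
  starProd K x y - starProd K y x

end Hopf

/-! ### Insertion of graphs -/

namespace FGraph

/-- Vertices. -/
def Vertex (Γ : FGraph) : Type := Quotient Γ.vert

/-- The vertex at which a half-edge lies. -/
def vertexOf (Γ : FGraph) (h : Γ.HalfEdge) : Γ.Vertex := Quotient.mk Γ.vert h

/-- Internal vertices, i.e. those which are not external. -/
def IntVertex (Γ : FGraph) : Type := {v : Γ.Vertex // ∀ h ∈ Γ.ext, Γ.vertexOf h ≠ v}

/-- The half-edges incident to an internal vertex. -/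
def IntVertex.Flag {Γ : FGraph} (v : Γ.IntVertex) : Type :=
  {h : Γ.HalfEdge // Γ.vertexOf h = v.1}

instance (Γ : FGraph) : Finite Γ.Vertex := inferInstanceAs (Finite (Quotient Γ.vert))

instance (Γ : FGraph) : Finite Γ.IntVertex :=
  inferInstanceAs (Finite {v : Γ.Vertex // ∀ h ∈ Γ.ext, Γ.vertexOf h ≠ v})

instance {Γ : FGraph} (v : Γ.IntVertex) : Finite v.Flag :=
  inferInstanceAs (Finite {h : Γ.HalfEdge // Γ.vertexOf h = v.1})

noncomputable instance (Γ : FGraph) : Fintype Γ.IntVertex := Fintype.ofFinite _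

noncomputable instance {Γ Γ' : FGraph} (v : Γ'.IntVertex) : Fintype (v.Flag ≃ Γ.ext) :=
  Fintype.ofFinite _

open Classical in
/-- Where the half-edges are attached after inserting `Γ` into `Γ'` at the vertex `v`: a half-edge
`h` at `v` moves to the vertex of `Γ` carrying the external edge of `Γ` which ends at the external
vertex `σ h`; every other half-edge stays at its vertex. -/
noncomputable def insertAttach (Γ Γ' : FGraph) (v : Γ'.IntVertex) (σ : v.Flag ≃ Γ.ext) :
    Γ'.HalfEdge ⊕ {h : Γ.HalfEdge // Γ.IsInternal h} → Γ'.HalfEdge ⊕ Γ.HalfEdge :=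
  Sum.elim
    (fun h => if hh : Γ'.vertexOf h = v.1 then .inr (Γ.mate (σ ⟨h, hh⟩).1) else .inl h)
    (fun h => .inr h.1)

/-- The graph obtained by inserting `Γ` into `Γ'` at the internal vertex `v` of `Γ'` by means of a
bijection `σ` from the half-edges at `v` to the external vertices of `Γ`. Its edges are the edges of
`Γ'` and the internal edges of `Γ`, and its external vertices are those of `Γ'`. -/
noncomputable def insert (Γ Γ' : FGraph) (v : Γ'.IntVertex) (σ : v.Flag ≃ Γ.ext) : FGraph where
  HalfEdge := Γ'.HalfEdge ⊕ {h : Γ.HalfEdge // Γ.IsInternal h}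
  finite := inferInstance
  mate := Sum.map Γ'.mate fun h => ⟨Γ.mate h.1, h.2.2, by rw [Γ.mate_mate]; exact h.2.1⟩
  mate_mate := by rintro (h | h) <;> simp [mate_mate]
  mate_ne := by
    rintro (h | h)
    · simp [mate_ne]
    · intro hh
      simp only [Sum.map_inr, Sum.inr.injEq] at hh
      exact Γ.mate_ne _ (congrArg Subtype.val hh)
  vert := (sumSetoid Γ'.vert Γ.vert).comap (insertAttach Γ Γ' v σ)
  ext := Sum.inl '' Γ'.ext
  ext_univalent := by
    rintro _ ⟨x, hx, rfl⟩ h hxh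
    have hxv : Γ'.vertexOf x ≠ v.1 := v.2 x hx
    rw [Setoid.comap_rel] at hxh
    rcases h with h | h
    · by_cases hh : Γ'.vertexOf h = v.1
      · simp [insertAttach, hxv, hh] at hxh
      · simp only [insertAttach, Sum.elim_inl, hxv, hh, dite_false, sumSetoid_inl_inl] at hxh
        rw [Γ'.ext_univalent x hx h hxh]
    · simp [insertAttach, hxv] at hxh

/-- The sum of all graphs obtained by inserting `Γ` into `Γ'` at the vertex `v`; it vanishes
if the valency of `v` is not the number of external vertices of `Γ`. -/
noncomputable def insertAt (K : Type*) [Field K] (Γ Γ' : FGraph) (v : Γ'.IntVertex) :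
    GraphSeries K :=
  ∑ σ : v.Flag ≃ Γ.ext, GraphSeries.of K (Γ.insert Γ' v σ)

/-- The insertion product `Γ ∘ Γ'`: the sum over all internal vertices of `Γ'` of the insertions
of `Γ` into `Γ'` at that vertex. -/
noncomputable def circ (K : Type*) [Field K] (Γ Γ' : FGraph) : GraphSeries K :=
  ∑ v : Γ'.IntVertex, insertAt K Γ Γ' v

end FGraph

namespace FGraph

/-! ### Connectedness and contractions -/

/-! Both sides are compared coefficient by coefficient. Write `ξᵢ` for the linear form `I(Γᵢ)`. By
duality, `|Aut Γ|` times the coefficient of `Γ` in `Γ₁ ⋆ Γ₂` is `(ξ₁ ⊗ ξ₂)(∇Γ)`, and in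
characteristic zero the factor `|Aut Γ|` can be cancelled.

If `Γ` is connected, then already `Γ₁ ⋆ Γ₂` and `Γ₁ ∘ Γ₂` have the same coefficient at `Γ`
(`starProd_apply_of_connected`). The terms `1 ⊗ Γ` and `Γ ⊗ 1` contribute nothing because `Γ₁` and
`Γ₂` are nonempty. The rest counts triples of a subgraph `γ`, an isomorphism of `Γ₁` with `γ` and
one of `Γ₂` with `Γ/γ` (`Extraction`). On the other side, `|Aut Γ|` times the coefficient in `Γ₁ ∘
Γ₂` counts triples of a vertex `v`, a bijection `σ` and an isomorphism of `Γ_{v,σ}` with `Γ`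
(`Insertion`). Remembering the isomorphisms removes all symmetry factors: the two kinds of triples
are in bijection, by taking the inserted copy of `Γ₁` as `γ`, and conversely by reinserting `γ` at
the vertex to which it was contracted. Connectedness of `Γ₁` makes `γ` contract to a single vertex,
and connectedness of `Γ` ensures that this vertex keeps a half-edge.

If `Γ` is not connected, `Γ₁ ⋆ Γ₂` may have a nonzero coefficient at `Γ`, but it is symmetric in the
two factors. Since `Γᵢ` is connected, `ξᵢ` is an infinitesimal character, and on a product of two
coproducts of elements `x`, `y` of the augmentation ideal `ξ₁ ⊗ ξ₂` takes the value `ξ₁(x) ξ₂(y) +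
ξ₂(x) ξ₁(y)` (`pairing_mul`, `pairing_coprod_comm`). So the commutator vanishes there. The insertion
products vanish too, an insertion of a connected graph into a connected graph being connected
(`insert_connected`). -/

theorem eqvGen_apply_eq {α : Type} {β : Sort*} {r : α → α → Prop} (f : α → β)
    (h : ∀ x y, r x y → f x = f y) {a b : α} (hab : Relation.EqvGen r a b) : f a = f b := by
  induction hab with
  | rel _ _ h' => exact h _ _ h'
  | refl => rfl
  | symm _ _ _ ih => exact ih.symm
  | trans _ _ _ _ _ ih₁ ih₂ => exact ih₁.trans ih₂

theorem eqvGen_map {α β : Type} {r : α → α → Prop} {s : β → β → Prop} (f : α → β)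
    (h : ∀ x y, r x y → Relation.EqvGen s (f x) (f y)) {a b : α}
    (hab : Relation.EqvGen r a b) : Relation.EqvGen s (f a) (f b) := by
  induction hab with
  | rel _ _ h' => exact h _ _ h'
  | refl => exact .refl _
  | symm _ _ _ ih => exact .symm _ _ ih
  | trans _ _ _ _ _ ih₁ ih₂ => exact .trans _ _ _ ih₁ ih₂

/-- Membership in such a set is constant along `Adj`. This is the form in which connectedness of a
graph is mostly exploited: exhibit a closed set and conclude that it is everything. -/
theorem Connected.mem_of_closed {Γ : FGraph} (hΓ : Γ.Connected) {T : Set Γ.HalfEdge}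
    (hv : ∀ x y, Γ.vert x y → x ∈ T → y ∈ T) (hm : ∀ x ∈ T, Γ.mate x ∈ T)
    {a : Γ.HalfEdge} (ha : a ∈ T) (b : Γ.HalfEdge) : b ∈ T := by
  have h := eqvGen_apply_eq (fun x => x ∈ T) (fun x y hxy => ?_) (hΓ.2 a b)
  · exact h ▸ ha
  · rcases hxy with hxy | rfl
    · exact propext ⟨hv _ _ hxy, hv _ _ (Γ.vert.symm hxy)⟩
    · exact propext ⟨hm _, fun h' => Γ.mate_mate x ▸ hm _ h'⟩

theorem Connected.of_iso {Γ Γ' : FGraph} (e : Iso Γ Γ') (hΓ : Γ.Connected) : Γ'.Connected := by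
  refine ⟨hΓ.1.map e.toEquiv, fun a b => ?_⟩
  have h := eqvGen_map (s := Γ'.Adj) e.toEquiv
    (fun x y hxy => .rel _ _ ((Adj.iff_map e x y).1 hxy))
    (hΓ.2 (e.toEquiv.symm a) (e.toEquiv.symm b))
  simp only [Equiv.apply_symm_apply] at h
  exact h

theorem IsInternal.mate {Γ : FGraph} {h : Γ.HalfEdge} (hh : Γ.IsInternal h) :
    Γ.IsInternal (Γ.mate h) := ⟨hh.2, by rw [Γ.mate_mate]; exact hh.1⟩

/-- In a connected graph with an internal edge, every internal vertex meets an internal edge. -/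
theorem exists_internal_vert {Γ : FGraph} (hc : Γ.Connected) (hi : Γ.HasInternalEdge)
    {x : Γ.HalfEdge} (hx : x ∉ Γ.ext) : ∃ k, Γ.IsInternal k ∧ Γ.vert k x := by
  by_contra! hno
  obtain ⟨k, hk⟩ := hi
  -- If no internal edge met the vertex of `x`, then the half-edges at this vertex together with
  -- their mates would already form a whole component.
  have hT : ∀ b, b ∈ {y | Γ.vert x y ∨ Γ.vert x (Γ.mate y)} := by
    refine hc.mem_of_closed ?_ ?_ (Or.inl (Γ.vert.refl x))
    · rintro y z hyz (hy | hy)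
      · exact Or.inl (Γ.vert.trans hy hyz)
      · have h1 : Γ.mate y ∉ Γ.ext := fun hm =>
          hx (Γ.ext_univalent _ hm _ (Γ.vert.symm hy) ▸ hm)
        have h2 : y ∈ Γ.ext := by
          by_contra h2
          exact hno _ (IsInternal.mate ⟨h2, h1⟩) (Γ.vert.symm hy)
        rw [Γ.ext_univalent _ h2 _ hyz]
        exact Or.inr hy
    · rintro y (hy | hy)
      · exact Or.inr (by rwa [Γ.mate_mate])
      · exact Or.inl hy
  rcases hT k with h | h
  · exact hno _ hk (Γ.vert.symm h)
  · exact hno _ hk.mate (Γ.vert.symm h)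

/-- In a connected graph with an internal edge, no edge joins two external vertices. -/
theorem mate_not_mem_ext {Γ : FGraph} (hc : Γ.Connected) (hi : Γ.HasInternalEdge)
    {x : Γ.HalfEdge} (hx : x ∈ Γ.ext) : Γ.mate x ∉ Γ.ext := by
  intro hm
  obtain ⟨k, hk⟩ := hi
  -- An edge joining two external vertices is a component by itself.
  have hT : k ∈ Γ.ext ∧ Γ.mate k ∈ Γ.ext := by
    refine hc.mem_of_closed (T := {y | y ∈ Γ.ext ∧ Γ.mate y ∈ Γ.ext}) ?_ ?_ (a := x) ⟨hx, hm⟩ k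
    · intro y z hyz hy
      rwa [Γ.ext_univalent _ hy.1 _ hyz]
    · rintro y ⟨h1, h2⟩
      exact ⟨h2, by rwa [Γ.mate_mate]⟩
  exact hk.1 hT.1

/-! ### Vertices of a contraction, inside and outside the support of the subgraph -/

namespace Subgraph

variable {Γ : FGraph} (γ : Γ.Subgraph)

theorem mem_support_of_vert {a b : Γ.HalfEdge} (ha : a ∈ γ.support) (hab : Γ.vert a b) :
    b ∈ γ.support := by
  obtain ⟨s, hs, hsa⟩ := ha
  exact ⟨s, hs, Γ.vert.trans hsa hab⟩

theorem not_mem_ext_of_mem_support {a : Γ.HalfEdge} (ha : a ∈ γ.support) : a ∉ Γ.ext := by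
  rintro hx
  obtain ⟨s, hs, hsa⟩ := ha
  have := Γ.ext_univalent _ hx _ (Γ.vert.symm hsa)
  exact (γ.internal _ hs).1 (this ▸ hx)

/-- A generator of `Merge` either stays at one vertex or runs along an edge of `γ`, both of whose
ends are in the support. Hence contraction never identifies a vertex of `γ` with one outside it. -/
theorem mem_support_iff_of_merge {a b : Γ.HalfEdge} (h : Relation.EqvGen γ.Merge a b) :
    a ∈ γ.support ↔ b ∈ γ.support := by
  refine iff_of_eq (eqvGen_apply_eq (fun x => x ∈ γ.support) (fun x y hxy => propext ?_) h)
  rcases hxy with hxy | ⟨hx, rfl⟩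
  · exact ⟨fun h => γ.mem_support_of_vert h hxy,
      fun h => γ.mem_support_of_vert h (Γ.vert.symm hxy)⟩
  · exact iff_of_true (γ.carrier_subset_support hx) (γ.carrier_subset_support (γ.mate_mem _ hx))

/-- A vertex outside the support meets no edge of `γ`, so contraction merges nothing into it. -/
theorem vert_of_merge {a b : Γ.HalfEdge} (ha : a ∉ γ.support)
    (h : Relation.EqvGen γ.Merge a b) : Γ.vert a b := by
  refine (iff_of_eq (eqvGen_apply_eq (fun x => Γ.vert a x) (fun x y hxy => propext ?_) h)).1
    (Γ.vert.refl a)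
  rcases hxy with hxy | ⟨hx, rfl⟩
  · exact ⟨fun h => Γ.vert.trans h hxy, fun h => Γ.vert.trans h (Γ.vert.symm hxy)⟩
  · exact iff_of_false (fun h => ha ⟨_, hx, Γ.vert.symm h⟩)
      (fun h => ha ⟨_, γ.mate_mem _ hx, Γ.vert.symm h⟩)

/-- The half-edge of the ambient graph underlying a half-edge of a subgraph. -/
noncomputable def val (x : γ.toGraph.HalfEdge) : Γ.HalfEdge :=
  Sum.elim (fun h : {h : Γ.HalfEdge // h ∈ γ.support} => h.1)
    (fun h : {h : Γ.HalfEdge // h ∈ γ.support ∧ h ∉ γ.carrier} => h.1) x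

theorem toGraph_mate_inl_mem (h : {h : Γ.HalfEdge // h ∈ γ.support}) (hh : h.1 ∈ γ.carrier) :
    γ.toGraph.mate (.inl h) =
      .inl ⟨Γ.mate h.1, γ.carrier_subset_support (γ.mate_mem _ hh)⟩ := dif_pos hh

theorem toGraph_mate_inl_not_mem (h : {h : Γ.HalfEdge // h ∈ γ.support})
    (hh : h.1 ∉ γ.carrier) : γ.toGraph.mate (.inl h) = .inr ⟨h.1, h.2, hh⟩ := dif_neg hh

/-- A connected subgraph is contracted to a single vertex. -/
theorem merge_of_mem_support (hc : γ.toGraph.Connected) {a b : Γ.HalfEdge}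
    (ha : a ∈ γ.support) (hb : b ∈ γ.support) : Relation.EqvGen γ.Merge a b := by
  refine eqvGen_map (r := γ.toGraph.Adj) (a := .inl ⟨a, ha⟩) (b := .inl ⟨b, hb⟩) γ.val
    (fun x y hxy => ?_) (hc.2 _ _)
  rcases hxy with hxy | rfl
  · rcases x with x | x <;> rcases y with y | y
    · exact .rel _ _ (Or.inl hxy)
    · exact hxy.elim
    · exact hxy.elim
    · obtain rfl : x = y := hxy
      exact .refl _
  · rcases x with x | x
    · by_cases hx : x.1 ∈ γ.carrier
      · rw [toGraph_mate_inl_mem γ x hx]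
        exact .rel _ _ (Or.inr ⟨hx, rfl⟩)
      · rw [toGraph_mate_inl_not_mem γ x hx]
        exact .refl _
    · exact .refl _

theorem conn_of_merge {a b : Γ.HalfEdge} (h : Relation.EqvGen γ.Merge a b) : Γ.conn a b := by
  refine eqvGen_map (s := Γ.Adj) id (fun x y hxy => ?_) h
  rcases hxy with hxy | ⟨_, rfl⟩
  · exact .rel _ _ (Or.inl hxy)
  · exact .rel _ _ (Or.inr rfl)

/-- A nontrivial subgraph of a connected graph has an external edge. -/
theorem exists_mem_support_not_mem (hΓ : Γ.Connected) (hγ : γ.Nontrivial) :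
    ∃ a ∈ γ.support, a ∉ γ.carrier := by
  by_contra! hno
  obtain ⟨⟨s, hs⟩, h, -, hh⟩ := hγ
  exact hh (hΓ.mem_of_closed (T := γ.carrier)
    (fun x y hxy hx => hno _ ⟨x, hx, hxy⟩) γ.mate_mem hs h)

end Subgraph

/-! ### The inserted graph as a subgraph -/

section Insert

variable {Γ Γ' : FGraph} (v : Γ'.IntVertex) (σ : v.Flag ≃ Γ.ext)

theorem insertAttach_inl_of_eq (h : Γ'.HalfEdge) (hh : Γ'.vertexOf h = v.1) :
    insertAttach Γ Γ' v σ (.inl h) = .inr (Γ.mate (σ ⟨h, hh⟩).1) := dif_pos hh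

theorem insertAttach_inl_of_ne (h : Γ'.HalfEdge) (hh : Γ'.vertexOf h ≠ v.1) :
    insertAttach Γ Γ' v σ (.inl h) = .inl h := dif_neg hh

/-- The subgraph of `Γ.insert Γ' v σ` formed by the internal edges of `Γ`. -/
def insertSubgraph : (Γ.insert Γ' v σ).Subgraph where
  carrier := Set.range Sum.inr
  mate_mem := by
    rintro _ ⟨k, rfl⟩
    exact ⟨_, rfl⟩
  internal := by
    rintro _ ⟨k, rfl⟩
    constructor
    · rintro ⟨_, _, h⟩
      cases h
    · rintro ⟨_, _, h⟩
      cases h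

theorem IntVertex.exists_rep (v : Γ'.IntVertex) : ∃ h, Γ'.vertexOf h = v.1 :=
  Quotient.exists_rep v.1

/-- The support consists of the half-edges attached to a vertex coming from `Γ`. For a half-edge of
`v` this is not automatic: its new vertex must meet an internal edge of `Γ`, which is provided by
`exists_internal_vert`. -/
theorem mem_support_insertSubgraph (hc : Γ.Connected) (hi : Γ.HasInternalEdge)
    (y : (Γ.insert Γ' v σ).HalfEdge) :
    y ∈ (insertSubgraph v σ).support ↔ ∃ z, insertAttach Γ Γ' v σ y = .inr z := by
  constructor
  · rintro ⟨_, ⟨k, rfl⟩, hv⟩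
    rcases hy : insertAttach Γ Γ' v σ y with z | z
    · have hv' : sumSetoid Γ'.vert Γ.vert (.inr k.1) (insertAttach Γ Γ' v σ y) := hv
      rw [hy] at hv'
      exact hv'.elim
    · exact ⟨z, rfl⟩
  · rintro ⟨z, hz⟩
    rcases y with y | y
    · by_cases hy : Γ'.vertexOf y = v.1
      · obtain ⟨k, hk, hkv⟩ := exists_internal_vert hc hi
          (mate_not_mem_ext hc hi (σ ⟨y, hy⟩).2)
        refine ⟨.inr ⟨k, hk⟩, ⟨_, rfl⟩, ?_⟩
        change sumSetoid Γ'.vert Γ.vert (.inr k) (insertAttach Γ Γ' v σ (.inl y))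
        rw [insertAttach_inl_of_eq v σ y hy]
        exact hkv
      · rw [insertAttach_inl_of_ne v σ y hy] at hz
        cases hz
    · exact Subgraph.carrier_subset_support _ ⟨y, rfl⟩

/-- The half-edge of `Γ` corresponding to a half-edge of `Γ.insert Γ' v σ` in the support of
the inserted subgraph. -/
noncomputable def insertCore (hc : Γ.Connected) (hi : Γ.HasInternalEdge)
    (y : (Γ.insert Γ' v σ).HalfEdge) (hy : y ∈ (insertSubgraph v σ).support) : Γ.HalfEdge :=
  ((mem_support_insertSubgraph v σ hc hi y).1 hy).choose

theorem insertAttach_eq_core (hc : Γ.Connected) (hi : Γ.HasInternalEdge)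
    (y : (Γ.insert Γ' v σ).HalfEdge) (hy : y ∈ (insertSubgraph v σ).support) :
    insertAttach Γ Γ' v σ y = .inr (insertCore v σ hc hi y hy) :=
  ((mem_support_insertSubgraph v σ hc hi y).1 hy).choose_spec

theorem insertCore_inl (hc : Γ.Connected) (hi : Γ.HasInternalEdge) (h : Γ'.HalfEdge)
    (hy : (Sum.inl h : (Γ.insert Γ' v σ).HalfEdge) ∈ (insertSubgraph v σ).support)
    (hh : Γ'.vertexOf h = v.1) :
    insertCore v σ hc hi (.inl h) hy = Γ.mate (σ ⟨h, hh⟩).1 :=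
  Sum.inr_injective ((insertAttach_eq_core v σ hc hi _ hy).symm.trans
    (insertAttach_inl_of_eq v σ h hh))

theorem insertCore_inr (hc : Γ.Connected) (hi : Γ.HasInternalEdge)
    (k : {h : Γ.HalfEdge // Γ.IsInternal h})
    (hy : (Sum.inr k : (Γ.insert Γ' v σ).HalfEdge) ∈ (insertSubgraph v σ).support) :
    insertCore v σ hc hi (.inr k) hy = k.1 :=
  Sum.inr_injective (insertAttach_eq_core v σ hc hi _ hy).symm

theorem inl_mem_support_insertSubgraph (hc : Γ.Connected) (hi : Γ.HasInternalEdge)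
    (h : Γ'.HalfEdge) :
    (Sum.inl h : (Γ.insert Γ' v σ).HalfEdge) ∈ (insertSubgraph v σ).support ↔
      Γ'.vertexOf h = v.1 := by
  refine (mem_support_insertSubgraph v σ hc hi _).trans ?_
  constructor
  · rintro ⟨z, hz⟩
    by_contra hh
    rw [insertAttach_inl_of_ne v σ h hh] at hz
    cases hz
  · intro hh
    exact ⟨_, insertAttach_inl_of_eq v σ h hh⟩

theorem inl_not_mem_insertSubgraph (h : Γ'.HalfEdge) :
    (Sum.inl h : (Γ.insert Γ' v σ).HalfEdge) ∉ (insertSubgraph v σ).carrier := by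
  rintro ⟨_, h⟩
  cases h

theorem insertCore_not_mem_ext (hc : Γ.Connected) (hi : Γ.HasInternalEdge)
    (y : (Γ.insert Γ' v σ).HalfEdge) (hy : y ∈ (insertSubgraph v σ).support) :
    insertCore v σ hc hi y hy ∉ Γ.ext := by
  rcases y with y | y
  · rw [insertCore_inl v σ hc hi y hy ((inl_mem_support_insertSubgraph v σ hc hi y).1 hy)]
    exact mate_not_mem_ext hc hi (Subtype.prop _)
  · rw [insertCore_inr v σ hc hi y hy]
    exact y.2.1

/-- A half-edge of the support outside the subgraph is a half-edge `h` of `v`, and its counterpart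
in `Γ` is the inner end of the external edge ending at `σ h`. -/
theorem insertCore_mate_mem_ext (hc : Γ.Connected) (hi : Γ.HasInternalEdge)
    (y : (Γ.insert Γ' v σ).HalfEdge) (hy : y ∈ (insertSubgraph v σ).support)
    (hy' : y ∉ (insertSubgraph v σ).carrier) :
    Γ.mate (insertCore v σ hc hi y hy) ∈ Γ.ext := by
  rcases y with y | y
  · rw [insertCore_inl v σ hc hi y hy ((inl_mem_support_insertSubgraph v σ hc hi y).1 hy),
      Γ.mate_mate]
    exact Subtype.prop _
  · exact absurd ⟨y, rfl⟩ hy'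

theorem insertCore_injective (hc : Γ.Connected) (hi : Γ.HasInternalEdge)
    (y z : (Γ.insert Γ' v σ).HalfEdge) (hy : y ∈ (insertSubgraph v σ).support)
    (hz : z ∈ (insertSubgraph v σ).support)
    (h : insertCore v σ hc hi y hy = insertCore v σ hc hi z hz) : y = z := by
  -- Half-edges of `v` and internal half-edges of `Γ` cannot collide: the former have cores whose
  -- mate is external.
  have key : ∀ w ∉ (insertSubgraph v σ).carrier, ∀ hw, ∀ k : {h : Γ.HalfEdge // Γ.IsInternal h},
      insertCore v σ hc hi w hw ≠ k.1 := fun w hw hw' k he =>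
    k.2.2 (he ▸ insertCore_mate_mem_ext v σ hc hi w hw' hw)
  rcases y with y | y <;> rcases z with z | z
  · rw [insertCore_inl v σ hc hi y hy ((inl_mem_support_insertSubgraph v σ hc hi y).1 hy),
      insertCore_inl v σ hc hi z hz ((inl_mem_support_insertSubgraph v σ hc hi z).1 hz)] at h
    have h1 := congrArg Γ.mate h
    rw [Γ.mate_mate, Γ.mate_mate] at h1
    exact congrArg Sum.inl (congrArg Subtype.val (σ.injective (Subtype.ext h1)))
  · rw [insertCore_inr] at h
    exact absurd h (key _ (inl_not_mem_insertSubgraph v σ y) _ _)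
  · rw [insertCore_inr] at h
    exact absurd h.symm (key _ (inl_not_mem_insertSubgraph v σ z) _ _)
  · rw [insertCore_inr, insertCore_inr] at h
    exact congrArg Sum.inr (Subtype.ext h)

/-- The map underlying `insertSubgraphIso`. -/
noncomputable def insertSubgraphMap (hc : Γ.Connected) (hi : Γ.HasInternalEdge) :
    (insertSubgraph v σ).toGraph.HalfEdge → Γ.HalfEdge :=
  Sum.elim (fun y => insertCore v σ hc hi y.1 y.2)
    (fun y => Γ.mate (insertCore v σ hc hi y.1 y.2.1))

/-- The half-edges of `Γ` are of three kinds: external vertices, their mates, and internal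
half-edges. They come respectively from the new external half-edges of the subgraph, from the
half-edges of `v`, and from the subgraph itself; surjectivity of `σ` covers the first two kinds. -/
theorem insertSubgraphMap_bijective (hc : Γ.Connected) (hi : Γ.HasInternalEdge) :
    Function.Bijective (insertSubgraphMap v σ hc hi) := by
  constructor
  · rintro (y | y) (z | z) h
    · exact congrArg Sum.inl (Subtype.ext (insertCore_injective v σ hc hi _ _ y.2 z.2 h))
    · refine absurd (insertCore_mate_mem_ext v σ hc hi _ z.2.1 z.2.2) ?_
      change insertCore v σ hc hi _ y.2 = Γ.mate (insertCore v σ hc hi _ z.2.1) at h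
      rw [← h]
      exact insertCore_not_mem_ext v σ hc hi _ y.2
    · refine absurd (insertCore_mate_mem_ext v σ hc hi _ y.2.1 y.2.2) ?_
      change Γ.mate (insertCore v σ hc hi _ y.2.1) = insertCore v σ hc hi _ z.2 at h
      rw [h]
      exact insertCore_not_mem_ext v σ hc hi _ z.2
    · have h1 := congrArg Γ.mate
        (show Γ.mate (insertCore v σ hc hi _ y.2.1) = Γ.mate (insertCore v σ hc hi _ z.2.1) from h)
      rw [Γ.mate_mate, Γ.mate_mate] at h1
      exact congrArg Sum.inr (Subtype.ext (insertCore_injective v σ hc hi _ _ y.2.1 z.2.1 h1))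
  · have hflag : ∀ x : Γ.ext, ∃ h : Γ'.HalfEdge, ∃ hh : Γ'.vertexOf h = v.1, σ ⟨h, hh⟩ = x :=
      fun x => ⟨(σ.symm x).1, (σ.symm x).2, σ.apply_symm_apply x⟩
    intro x
    by_cases hx : x ∈ Γ.ext
    · obtain ⟨h, hh, hσ⟩ := hflag ⟨x, hx⟩
      have hs := (inl_mem_support_insertSubgraph v σ hc hi h).2 hh
      refine ⟨.inr ⟨.inl h, hs, inl_not_mem_insertSubgraph v σ h⟩, ?_⟩
      change Γ.mate (insertCore v σ hc hi _ _) = x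
      rw [insertCore_inl v σ hc hi h hs hh, hσ, Γ.mate_mate]
    · by_cases hm : Γ.mate x ∈ Γ.ext
      · obtain ⟨h, hh, hσ⟩ := hflag ⟨_, hm⟩
        have hs := (inl_mem_support_insertSubgraph v σ hc hi h).2 hh
        refine ⟨.inl ⟨.inl h, hs⟩, ?_⟩
        change insertCore v σ hc hi _ hs = x
        rw [insertCore_inl v σ hc hi h hs hh, hσ, Γ.mate_mate]
      · refine ⟨.inl ⟨.inr ⟨x, hx, hm⟩, Subgraph.carrier_subset_support _ ⟨_, rfl⟩⟩, ?_⟩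
        exact insertCore_inr v σ hc hi ⟨x, hx, hm⟩ (Subgraph.carrier_subset_support _ ⟨_, rfl⟩)

/-- The inserted subgraph is isomorphic to the graph that was inserted. -/
noncomputable def insertSubgraphIso (hc : Γ.Connected) (hi : Γ.HasInternalEdge) :
    Iso (insertSubgraph v σ).toGraph Γ where
  toEquiv := Equiv.ofBijective _ (insertSubgraphMap_bijective v σ hc hi)
  map_mate := by
    rintro (y | y)
    · by_cases hy : y.1 ∈ (insertSubgraph v σ).carrier
      · rw [Subgraph.toGraph_mate_inl_mem _ y hy]
        obtain ⟨y | y, hy'⟩ := y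
        · exact absurd hy (inl_not_mem_insertSubgraph v σ y)
        exact (insertCore_inr v σ hc hi _
            (Subgraph.carrier_subset_support _ ⟨_, rfl⟩)).trans
          (congrArg Γ.mate (insertCore_inr v σ hc hi y hy').symm)
      · rw [Subgraph.toGraph_mate_inl_not_mem _ y hy]
        rfl
    · exact (Γ.mate_mate _).symm
  map_vert := by
    have key : ∀ y : {h // h ∈ (insertSubgraph v σ).support ∧ h ∉ (insertSubgraph v σ).carrier},
        insertSubgraphMap v σ hc hi (.inr y) ∈ Γ.ext := fun y =>
      insertCore_mate_mem_ext v σ hc hi y.1 y.2.1 y.2.2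
    have hinj := (insertSubgraphMap_bijective v σ hc hi).1
    have key' : ∀ a b, insertSubgraphMap v σ hc hi a ∈ Γ.ext →
        Γ.vert (insertSubgraphMap v σ hc hi a) (insertSubgraphMap v σ hc hi b) → b = a :=
      fun a b ha h => hinj (Γ.ext_univalent _ ha _ h)
    rintro (a | a) (b | b)
    · change sumSetoid Γ'.vert Γ.vert (insertAttach Γ Γ' v σ a.1) (insertAttach Γ Γ' v σ b.1) ↔ _
      rw [insertAttach_eq_core v σ hc hi a.1 a.2, insertAttach_eq_core v σ hc hi b.1 b.2]
      rfl
    · refine iff_of_false id fun h => ?_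
      have := key' _ (.inl a) (key b) (Γ.vert.symm h)
      cases this
    · refine iff_of_false id fun h => ?_
      have := key' _ (.inl b) (key a) h
      cases this
    · constructor
      · intro h
        obtain rfl : a = b := h
        exact Γ.vert.refl _
      · intro h
        obtain rfl := Sum.inr_injective (key' _ (.inr b) (key a) h)
        exact (insertSubgraph v σ).toGraph.vert.refl _
  map_ext := by
    rintro (y | y)
    · refine iff_of_false ?_ (insertCore_not_mem_ext v σ hc hi _ y.2)
      rintro ⟨_, h⟩
      cases h
    · exact iff_of_true ⟨y, rfl⟩ (insertCore_mate_mem_ext v σ hc hi _ _ y.2.2)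

theorem insertSubgraph_toGraph_connected (hc : Γ.Connected) (hi : Γ.HasInternalEdge) :
    (insertSubgraph v σ).toGraph.Connected := hc.of_iso (insertSubgraphIso v σ hc hi).symm

theorem insert_vert_inl_iff_of_ne {a : Γ'.HalfEdge} (b : Γ'.HalfEdge)
    (ha : Γ'.vertexOf a ≠ v.1) :
    (Γ.insert Γ' v σ).vert (.inl a) (.inl b) ↔ Γ'.vert a b := by
  change sumSetoid Γ'.vert Γ.vert (insertAttach Γ Γ' v σ (.inl a))
    (insertAttach Γ Γ' v σ (.inl b)) ↔ _
  rw [insertAttach_inl_of_ne v σ a ha]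
  by_cases hb : Γ'.vertexOf b = v.1
  · rw [insertAttach_inl_of_eq v σ b hb]
    refine iff_of_false id fun h => ha ?_
    exact (Quotient.sound h).trans hb
  · rw [insertAttach_inl_of_ne v σ b hb]
    rfl

/-- Insertion distributes the half-edges of `v` over the vertices of `Γ`. Since `Γ` is connected,
contracting its internal edges brings them together again; at the other vertices nothing has
changed. -/
theorem merge_inl_of_vert (hc : Γ.Connected) (hi : Γ.HasInternalEdge)
    {a b : Γ'.HalfEdge} (h : Γ'.vert a b) :
    Relation.EqvGen (insertSubgraph v σ).Merge (.inl a) (.inl b) := by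
  by_cases ha : Γ'.vertexOf a = v.1
  · have hb : Γ'.vertexOf b = v.1 := (Quotient.sound (Γ'.vert.symm h)).trans ha
    exact Subgraph.merge_of_mem_support _ (insertSubgraph_toGraph_connected v σ hc hi)
      ((inl_mem_support_insertSubgraph v σ hc hi a).2 ha)
      ((inl_mem_support_insertSubgraph v σ hc hi b).2 hb)
  · exact .rel _ _ (Or.inl ((insert_vert_inl_iff_of_ne v σ b ha).2 h))

/-- Sending every half-edge of the inserted graph to `v`, and every other one to its old vertex, is
constant along `Merge`, so contraction identifies no further vertices of `Γ'`. -/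
theorem vert_of_merge_inl {a b : Γ'.HalfEdge}
    (h : Relation.EqvGen (insertSubgraph v σ).Merge (.inl a) (.inl b)) : Γ'.vert a b := by
  refine Quotient.exact (s := Γ'.vert) (eqvGen_apply_eq
    (fun y : (Γ.insert Γ' v σ).HalfEdge =>
      (Sum.elim (fun h => Γ'.vertexOf h) (fun _ => v.1) y : Γ'.Vertex)) ?_ h)
  -- The map to vertices of `Γ'` factors through `insertAttach`, which defines the vertices of the
  -- insertion.
  have key : ∀ y : (Γ.insert Γ' v σ).HalfEdge,
      (Sum.elim (fun h => Γ'.vertexOf h) (fun _ => v.1) y : Γ'.Vertex) =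
        Sum.elim (fun h => Γ'.vertexOf h) (fun _ => v.1) (insertAttach Γ Γ' v σ y) := by
    rintro (y | y)
    · by_cases hy : Γ'.vertexOf y = v.1
      · rw [insertAttach_inl_of_eq v σ y hy]
        exact hy
      · rw [insertAttach_inl_of_ne v σ y hy]
        rfl
    · rfl
  rintro x y (hxy | ⟨⟨k, rfl⟩, rfl⟩)
  · have hxy' : sumSetoid Γ'.vert Γ.vert (insertAttach Γ Γ' v σ x)
      (insertAttach Γ Γ' v σ y) := hxy
    rw [key x, key y]
    generalize insertAttach Γ Γ' v σ x = x' at hxy'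
    generalize insertAttach Γ Γ' v σ y = y' at hxy'
    rcases x' with x' | x' <;> rcases y' with y' | y'
    · exact Quotient.sound hxy'
    · exact hxy'.elim
    · exact hxy'.elim
    · rfl
  · rfl

/-- Contracting the inserted subgraph gives back the graph into which it was inserted. -/
noncomputable def insertContractIso (hc : Γ.Connected) (hi : Γ.HasInternalEdge) :
    Iso Γ' ((Γ.insert Γ' v σ).contract (insertSubgraph v σ)) where
  toEquiv := Equiv.ofBijective
    (fun h => (⟨.inl h, inl_not_mem_insertSubgraph v σ h⟩ :
      {y : (Γ.insert Γ' v σ).HalfEdge // y ∉ (insertSubgraph v σ).carrier}))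
    ⟨fun a b h => Sum.inl_injective (congrArg Subtype.val h), by
      rintro ⟨y | y, hy⟩
      · exact ⟨y, rfl⟩
      · exact absurd (Set.mem_range_self y) hy⟩
  map_mate _ := rfl
  map_vert _ _ := ⟨merge_inl_of_vert v σ hc hi, vert_of_merge_inl v σ⟩
  map_ext _ := ⟨fun h => ⟨_, h, rfl⟩, fun ⟨_, h, he⟩ => Sum.inl_injective he ▸ h⟩

/-- A path in `Γ'` lifts to the insertion: where it passes through `v`, it is completed by a path
inside the connected inserted graph. -/
theorem insert_connected (hc : Γ.Connected) (hi : Γ.HasInternalEdge) (hc' : Γ'.Connected) :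
    (Γ.insert Γ' v σ).Connected := by
  obtain ⟨h₀, hh₀⟩ := v.exists_rep
  have key : ∀ y : (Γ.insert Γ' v σ).HalfEdge, (Γ.insert Γ' v σ).conn y (.inl h₀) := by
    rintro (y | y)
    · refine eqvGen_map (s := (Γ.insert Γ' v σ).Adj) Sum.inl (fun a b hab => ?_) (hc'.2 y h₀)
      rcases hab with hab | rfl
      · exact Subgraph.conn_of_merge _ (merge_inl_of_vert v σ hc hi hab)
      · exact .rel _ _ (Or.inr rfl)
    · exact Subgraph.conn_of_merge _ (Subgraph.merge_of_mem_support _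
        (insertSubgraph_toGraph_connected v σ hc hi)
        (Subgraph.carrier_subset_support _ ⟨y, rfl⟩)
        ((inl_mem_support_insertSubgraph v σ hc hi h₀).2 hh₀))
  exact ⟨⟨.inl h₀⟩, fun a b => (Γ.insert Γ' v σ).conn.trans (key a)
    ((Γ.insert Γ' v σ).conn.symm (key b))⟩

/-- An internal edge of `Γ` makes the subgraph nonempty, and an internal edge of `Γ'` remains
outside it. Here both graphs need an internal edge. -/
theorem insertSubgraph_nontrivial (hi : Γ.HasInternalEdge) (hi' : Γ'.HasInternalEdge) :
    (insertSubgraph v σ).Nontrivial := by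
  obtain ⟨k, hk⟩ := hi
  obtain ⟨h, hh⟩ := hi'
  refine ⟨⟨_, ⟨⟨k, hk⟩, rfl⟩⟩, .inl h, ⟨?_, ?_⟩, inl_not_mem_insertSubgraph v σ h⟩
  · rintro ⟨_, h', he⟩
    exact hh.1 (Sum.inl_injective he ▸ h')
  · rintro ⟨_, h', he⟩
    exact hh.2 (Sum.inl_injective he ▸ h')

end Insert

/-! ### Insertions and extractions correspond to each other -/

/-- A nontrivial subgraph of `Γ` identified with `Γ₁`, together with an identification of
its contraction with `Γ₂`. -/
structure Extraction (Γ₁ Γ₂ Γ : FGraph) where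
  sub : {γ : Γ.Subgraph // γ.Nontrivial}
  fst : Iso Γ₁ sub.1.toGraph
  snd : Iso Γ₂ (Γ.contract sub.1)

/-- An insertion of `Γ₁` into `Γ₂` identified with `Γ`. -/
structure Insertion (Γ₁ Γ₂ Γ : FGraph) where
  vertex : Γ₂.IntVertex
  bij : vertex.Flag ≃ Γ₁.ext
  iso : Iso (Γ₁.insert Γ₂ vertex bij) Γ

theorem Iso.ext {Γ Γ' : FGraph} {e f : Iso Γ Γ'} (h : ∀ x, e.toEquiv x = f.toEquiv x) : e = f :=
  Iso.toEquiv_injective (Equiv.ext h)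

variable {Γ₁ Γ₂ Γ : FGraph}

namespace Extraction

/-- The half-edge of `Γ` underlying a half-edge of `Γ₁`. -/
noncomputable def fstVal (x : Extraction Γ₁ Γ₂ Γ) (h : Γ₁.HalfEdge) : Γ.HalfEdge :=
  x.sub.1.val (x.fst.toEquiv h)

/-- The half-edge of `Γ` underlying a half-edge of `Γ₂`. -/
def sndVal (x : Extraction Γ₁ Γ₂ Γ) (h : Γ₂.HalfEdge) : Γ.HalfEdge :=
  (x.snd.toEquiv h).1

theorem mem_carrier_iff (x : Extraction Γ₁ Γ₂ Γ) (y : Γ.HalfEdge) :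
    y ∈ x.sub.1.carrier ↔ y ∉ Set.range x.sndVal := by
  constructor
  · rintro hy ⟨h, rfl⟩
    exact (x.snd.toEquiv h).2 hy
  · intro hy
    by_contra hy'
    exact hy ⟨x.snd.toEquiv.symm ⟨y, hy'⟩,
      congrArg Subtype.val (x.snd.toEquiv.apply_symm_apply ⟨y, hy'⟩)⟩

/-- `val` fails to be injective only in that the two ends of an external edge of `γ` have the same
image, and exactly one of these ends is external. -/
theorem val_injOn {γ : Γ.Subgraph} {y z : γ.toGraph.HalfEdge}
    (hyz : y ∈ γ.toGraph.ext ↔ z ∈ γ.toGraph.ext) (h : γ.val y = γ.val z) : y = z := by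
  rcases y with y | y <;> rcases z with z | z
  · exact congrArg Sum.inl (Subtype.ext h)
  · obtain ⟨_, h⟩ := hyz.2 ⟨z, rfl⟩
    cases h
  · obtain ⟨_, h⟩ := hyz.1 ⟨y, rfl⟩
    cases h
  · exact congrArg Sum.inr (Subtype.ext h)

/-- The subgraph is the complement of the image of `sndVal`, and the isomorphisms are then recovered
by `val_injOn`. Extractions can thus be compared through maps into the fixed set of half-edges of
`Γ`, although their isomorphisms have targets depending on the subgraph. -/
theorem ext_val {x y : Extraction Γ₁ Γ₂ Γ} (h₁ : x.fstVal = y.fstVal)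
    (h₂ : x.sndVal = y.sndVal) : x = y := by
  have hsub : x.sub = y.sub := by
    apply Subtype.ext
    apply Subgraph.ext
    ext h
    rw [mem_carrier_iff, mem_carrier_iff, h₂]
  obtain ⟨γ, f, g⟩ := x
  obtain ⟨γ', f', g'⟩ := y
  obtain rfl : γ = γ' := hsub
  obtain rfl : f = f' := Iso.ext fun h =>
    val_injOn ((f.map_ext h).symm.trans (f'.map_ext h)) (congrFun h₁ h)
  obtain rfl : g = g' := Iso.ext fun h => Subtype.ext (congrFun h₂ h)
  rfl

end Extraction

/-! ### From insertions to extractions -/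

namespace Insertion

theorem ext_val {x y : Insertion Γ₁ Γ₂ Γ}
    (hv : ∀ h, Γ₂.vertexOf h = x.vertex.1 → Γ₂.vertexOf h = y.vertex.1)
    (hσ : ∀ h hx hy, x.bij ⟨h, hx⟩ = y.bij ⟨h, hy⟩)
    (h₁ : ∀ h : Γ₂.HalfEdge, x.iso.toEquiv (.inl h) = y.iso.toEquiv (.inl h))
    (h₂ : ∀ k : {h : Γ₁.HalfEdge // Γ₁.IsInternal h},
      x.iso.toEquiv (.inr k) = y.iso.toEquiv (.inr k)) : x = y := by
  obtain ⟨v, σ, φ⟩ := x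
  obtain ⟨v', σ', φ'⟩ := y
  obtain rfl : v = v' := by
    obtain ⟨h, hh⟩ := v.exists_rep
    exact Subtype.ext (hh.symm.trans (hv h hh))
  obtain rfl : σ = σ' := Equiv.ext fun h => hσ h.1 h.2 h.2
  obtain rfl : φ = φ' := Iso.ext fun h => by
    rcases h with h | h
    · exact h₁ h
    · exact h₂ h
  rfl

/-- The subgraph formed by the inserted graph. -/
noncomputable def toExtraction (hc : Γ₁.Connected) (hi₁ : Γ₁.HasInternalEdge)
    (hi₂ : Γ₂.HasInternalEdge) (x : Insertion Γ₁ Γ₂ Γ) : Extraction Γ₁ Γ₂ Γ where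
  sub := ⟨(insertSubgraph x.vertex x.bij).map x.iso,
    Subgraph.nontrivial_map _ _ (insertSubgraph_nontrivial _ _ hi₁ hi₂)⟩
  fst := (insertSubgraphIso x.vertex x.bij hc hi₁).symm.trans
    (subgraphIso x.iso (insertSubgraph x.vertex x.bij))
  snd := (insertContractIso x.vertex x.bij hc hi₁).trans
    (contractIso x.iso (insertSubgraph x.vertex x.bij))

section

variable (hc : Γ₁.Connected) (hi₁ : Γ₁.HasInternalEdge) (hi₂ : Γ₂.HasInternalEdge)
  (x : Insertion Γ₁ Γ₂ Γ)

theorem val_subgraphIso {Γ Γ' : FGraph} (e : Iso Γ Γ') (γ : Γ.Subgraph)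
    (y : γ.toGraph.HalfEdge) :
    (γ.map e).val ((subgraphIso e γ).toEquiv y) = e.toEquiv (γ.val y) := by
  rcases y with y | y <;> rfl

/-- `fstVal` involves the inverse of `insertSubgraphMap`, so it is evaluated by supplying a preimage
`y` of `h`. -/
theorem toExtraction_fstVal_of_eq {h : Γ₁.HalfEdge}
    {y : (insertSubgraph x.vertex x.bij).toGraph.HalfEdge}
    (hy : insertSubgraphMap x.vertex x.bij hc hi₁ y = h) :
    (x.toExtraction hc hi₁ hi₂).fstVal h =
      x.iso.toEquiv ((insertSubgraph x.vertex x.bij).val y) := by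
  have hy' : (insertSubgraphIso x.vertex x.bij hc hi₁).toEquiv.symm h = y :=
    (Equiv.symm_apply_eq _).2 hy.symm
  refine (val_subgraphIso x.iso _ _).trans (congrArg (fun z => x.iso.toEquiv
    ((insertSubgraph x.vertex x.bij).val z)) hy')

theorem toExtraction_fstVal_internal (k : {h : Γ₁.HalfEdge // Γ₁.IsInternal h}) :
    (x.toExtraction hc hi₁ hi₂).fstVal k.1 = x.iso.toEquiv (.inr k) :=
  toExtraction_fstVal_of_eq hc hi₁ hi₂ x
    (y := .inl ⟨.inr k, Subgraph.carrier_subset_support _ ⟨_, rfl⟩⟩)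
    (insertCore_inr x.vertex x.bij hc hi₁ k (Subgraph.carrier_subset_support _ ⟨_, rfl⟩))

theorem toExtraction_fstVal_ext (h : Γ₂.HalfEdge) (hh : Γ₂.vertexOf h = x.vertex.1) :
    (x.toExtraction hc hi₁ hi₂).fstVal (x.bij ⟨h, hh⟩).1 = x.iso.toEquiv (.inl h) := by
  have hs := (inl_mem_support_insertSubgraph x.vertex x.bij hc hi₁ h).2 hh
  refine toExtraction_fstVal_of_eq hc hi₁ hi₂ x
    (y := .inr ⟨.inl h, hs, inl_not_mem_insertSubgraph x.vertex x.bij h⟩) ?_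
  refine (congrArg Γ₁.mate (insertCore_inl x.vertex x.bij hc hi₁ h hs hh)).trans ?_
  exact Γ₁.mate_mate _

/-- All data of an insertion can be read off from the extraction: `v` from the support of the
subgraph, `σ` from the values of `fstVal` on external vertices, and the isomorphism from `sndVal` on
half-edges of `Γ₂` and from `fstVal` on internal half-edges of `Γ₁`. -/
theorem toExtraction_injective :
    Function.Injective (toExtraction (Γ := Γ) hc hi₁ hi₂) := by
  intro x y hxy
  have hinl : ∀ h : Γ₂.HalfEdge, x.iso.toEquiv (.inl h) = y.iso.toEquiv (.inl h) := fun h =>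
    congrArg (fun z => z.sndVal h) hxy
  have hv : ∀ h, Γ₂.vertexOf h = x.vertex.1 → Γ₂.vertexOf h = y.vertex.1 := by
    intro h hh
    have h1 := (Subgraph.mem_support_map x.iso _ _).2
      ((inl_mem_support_insertSubgraph x.vertex x.bij hc hi₁ h).2 hh)
    have h2 : ((insertSubgraph x.vertex x.bij).map x.iso).support =
        ((insertSubgraph y.vertex y.bij).map y.iso).support :=
      congrArg (fun z => z.sub.1.support) hxy
    rw [h2, hinl] at h1
    exact (inl_mem_support_insertSubgraph y.vertex y.bij hc hi₁ h).1
      ((Subgraph.mem_support_map y.iso _ _).1 h1)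
  refine ext_val hv (fun h hx hy => ?_) hinl fun k => ?_
  · have h1 := toExtraction_fstVal_ext hc hi₁ hi₂ x h hx
    have h2 := toExtraction_fstVal_ext hc hi₁ hi₂ y h hy
    rw [hinl, ← h2, hxy] at h1
    exact Subtype.ext ((y.toExtraction hc hi₁ hi₂).fst.toEquiv.injective
      (Extraction.val_injOn (iff_of_true
        (((y.toExtraction hc hi₁ hi₂).fst.map_ext _).1 (Subtype.prop _))
        (((y.toExtraction hc hi₁ hi₂).fst.map_ext _).1 (Subtype.prop _))) h1))
  · rw [← toExtraction_fstVal_internal hc hi₁ hi₂ x k, hxy,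
      toExtraction_fstVal_internal hc hi₁ hi₂ y k]

end

end Insertion

/-! ### From extractions to insertions -/

namespace Extraction

theorem sndVal_injective (x : Extraction Γ₁ Γ₂ Γ) : Function.Injective x.sndVal :=
  Subtype.val_injective.comp x.snd.toEquiv.injective

theorem sndVal_not_mem (x : Extraction Γ₁ Γ₂ Γ) (h : Γ₂.HalfEdge) :
    x.sndVal h ∉ x.sub.1.carrier := (x.snd.toEquiv h).2

theorem exists_sndVal_eq (x : Extraction Γ₁ Γ₂ Γ) {y : Γ.HalfEdge} (hy : y ∉ x.sub.1.carrier) :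
    ∃ h, x.sndVal h = y := by
  rwa [mem_carrier_iff, not_not] at hy

theorem vert_iff_merge (x : Extraction Γ₁ Γ₂ Γ) (a b : Γ₂.HalfEdge) :
    Γ₂.vert a b ↔ Relation.EqvGen x.sub.1.Merge (x.sndVal a) (x.sndVal b) :=
  x.snd.map_vert a b

/-- The vertex of `Γ₂` to which the subgraph is contracted. -/
theorem exists_vertex (x : Extraction Γ₁ Γ₂ Γ) (hΓ : Γ.Connected) (hc : Γ₁.Connected) :
    ∃ v : Γ₂.IntVertex, ∀ h, Γ₂.vertexOf h = v.1 ↔ x.sndVal h ∈ x.sub.1.support := by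
  -- The vertex is represented by a half-edge at the subgraph that does not belong to it and hence
  -- survives the contraction.
  obtain ⟨a, ha, ha'⟩ := x.sub.1.exists_mem_support_not_mem hΓ x.sub.2
  obtain ⟨h₀, rfl⟩ := x.exists_sndVal_eq ha'
  have key : ∀ h, Γ₂.vertexOf h = Γ₂.vertexOf h₀ ↔ x.sndVal h ∈ x.sub.1.support := by
    intro h
    have h1 : Γ₂.vertexOf h = Γ₂.vertexOf h₀ ↔ Γ₂.vert h h₀ := Quotient.eq
    rw [h1, vert_iff_merge]
    exact ⟨fun h => (Subgraph.mem_support_iff_of_merge _ h).2 ha,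
      fun h => Subgraph.merge_of_mem_support _ (hc.of_iso x.fst) h ha⟩
  exact ⟨⟨Γ₂.vertexOf h₀, fun h hh he =>
    Subgraph.not_mem_ext_of_mem_support _ ((key h).1 he) ((x.snd.map_ext h).1 hh)⟩, key⟩

/-- In `toGraph` the new half-edges are external, and an old half-edge outside the subgraph has a
new one as its mate; so an internal half-edge can only come from the subgraph. -/
theorem exists_fst_eq_inl (x : Extraction Γ₁ Γ₂ Γ) {k : Γ₁.HalfEdge} (hk : Γ₁.IsInternal k) :
    ∃ (z : Γ.HalfEdge) (hz : z ∈ x.sub.1.carrier),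
      x.fst.toEquiv k = .inl ⟨z, x.sub.1.carrier_subset_support hz⟩ := by
  have h1 : x.fst.toEquiv k ∉ x.sub.1.toGraph.ext := fun h => hk.1 ((x.fst.map_ext k).2 h)
  have h2 : x.sub.1.toGraph.mate (x.fst.toEquiv k) ∉ x.sub.1.toGraph.ext := fun h =>
    hk.2 ((x.fst.map_ext _).2 (x.fst.map_mate k ▸ h))
  rcases hz : x.fst.toEquiv k with z | z
  · rw [hz] at h2
    have hz' : z.1 ∈ x.sub.1.carrier := by
      by_contra hz'
      rw [Subgraph.toGraph_mate_inl_not_mem _ z hz'] at h2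
      exact h2 ⟨_, rfl⟩
    exact ⟨z.1, hz', rfl⟩
  · exact absurd ⟨z, hz.symm⟩ h1

/-- The half-edge of `Γ₁` corresponding to a half-edge in the support of the subgraph. -/
noncomputable def core (x : Extraction Γ₁ Γ₂ Γ) (y : Γ.HalfEdge) (hy : y ∈ x.sub.1.support) :
    Γ₁.HalfEdge := x.fst.toEquiv.symm (.inl ⟨y, hy⟩)

theorem fst_core (x : Extraction Γ₁ Γ₂ Γ) (y : Γ.HalfEdge) (hy : y ∈ x.sub.1.support) :
    x.fst.toEquiv (x.core y hy) = .inl ⟨y, hy⟩ := x.fst.toEquiv.apply_symm_apply _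

theorem isInternal_core (x : Extraction Γ₁ Γ₂ Γ) {z : Γ.HalfEdge}
    (hz : z ∈ x.sub.1.carrier) :
    Γ₁.IsInternal (x.core z (x.sub.1.carrier_subset_support hz)) := by
  refine (IsInternal.iff_map x.fst _).2 ?_
  rw [fst_core]
  constructor
  · rintro ⟨_, h⟩
    cases h
  · rw [Subgraph.toGraph_mate_inl_mem _ _ hz]
    rintro ⟨_, h⟩
    cases h

section

variable (x : Extraction Γ₁ Γ₂ Γ) (v : Γ₂.IntVertex)
  (hv : ∀ h, Γ₂.vertexOf h = v.1 ↔ x.sndVal h ∈ x.sub.1.support)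

include hv in
/-- The half-edges at the vertex to which the subgraph is contracted correspond to the
external vertices of the subgraph. -/
theorem exists_flagEquiv : ∃ σ : v.Flag ≃ Γ₁.ext, ∀ h : v.Flag,
    x.fst.toEquiv (σ h).1 = .inr ⟨x.sndVal h.1, (hv h.1).1 h.2, x.sndVal_not_mem h.1⟩ := by
  let f : v.Flag → x.sub.1.toGraph.HalfEdge := fun h =>
    .inr ⟨x.sndVal h.1, (hv h.1).1 h.2, x.sndVal_not_mem h.1⟩
  have hf : ∀ h, x.fst.toEquiv.symm (f h) ∈ Γ₁.ext := fun h => by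
    rw [x.fst.map_ext, Equiv.apply_symm_apply]
    exact ⟨_, rfl⟩
  refine ⟨Equiv.ofBijective (fun h => ⟨x.fst.toEquiv.symm (f h), hf h⟩) ⟨fun a b hab => ?_, ?_⟩,
    fun h => x.fst.toEquiv.apply_symm_apply (f h)⟩
  · have h1 := x.fst.toEquiv.symm.injective (congrArg Subtype.val hab)
    exact Subtype.ext (x.sndVal_injective (congrArg x.sub.1.val h1))
  · rintro ⟨e, he⟩
    obtain ⟨z, hz⟩ := (x.fst.map_ext e).1 he
    obtain ⟨h, hh⟩ := x.exists_sndVal_eq z.2.2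
    refine ⟨⟨h, (hv h).2 (hh ▸ z.2.1)⟩, Subtype.ext ((Equiv.symm_apply_eq _).2 ?_)⟩
    rw [← hz]
    exact congrArg Sum.inr (Subtype.ext hh)

end

section

variable (x : Extraction Γ₁ Γ₂ Γ) (v : Γ₂.IntVertex) (σ : v.Flag ≃ Γ₁.ext)

/-- The map underlying `insertIso`. -/
noncomputable def insertMap : (Γ₁.insert Γ₂ v σ).HalfEdge → Γ.HalfEdge :=
  Sum.elim x.sndVal fun k => x.fstVal k.1

theorem fstVal_internal_mem {k : Γ₁.HalfEdge} (hk : Γ₁.IsInternal k) :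
    x.fstVal k ∈ x.sub.1.carrier := by
  obtain ⟨z, hz, h⟩ := x.exists_fst_eq_inl hk
  rw [fstVal, h]
  exact hz

theorem fst_internal {k : Γ₁.HalfEdge} (hk : Γ₁.IsInternal k) :
    x.fst.toEquiv k =
      .inl ⟨x.fstVal k, x.sub.1.carrier_subset_support (x.fstVal_internal_mem hk)⟩ := by
  obtain ⟨z, hz, h⟩ := x.exists_fst_eq_inl hk
  rw [h]
  refine congrArg Sum.inl (Subtype.ext ?_)
  change z = x.sub.1.val (x.fst.toEquiv k)
  rw [h]
  rfl

/-- The half-edges of `Γ` outside the subgraph are those of `Γ₂`, and those of the subgraph are the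
internal half-edges of `Γ₁`. -/
theorem insertMap_bijective : Function.Bijective (x.insertMap v σ) := by
  constructor
  · rintro (a | a) (b | b) hab
    · exact congrArg Sum.inl (x.sndVal_injective hab)
    · refine absurd (x.fstVal_internal_mem b.2) ?_
      rw [← show x.sndVal a = x.fstVal b.1 from hab]
      exact x.sndVal_not_mem a
    · refine absurd (x.fstVal_internal_mem a.2) ?_
      rw [show x.fstVal a.1 = x.sndVal b from hab]
      exact x.sndVal_not_mem b
    · refine congrArg Sum.inr (Subtype.ext (x.fst.toEquiv.injective ?_))
      rw [x.fst_internal a.2, x.fst_internal b.2]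
      exact congrArg Sum.inl (Subtype.ext hab)
  · intro y
    by_cases hy : y ∈ x.sub.1.carrier
    · refine ⟨.inr ⟨_, x.isInternal_core hy⟩, ?_⟩
      exact congrArg x.sub.1.val (x.fst_core y (x.sub.1.carrier_subset_support hy))
    · obtain ⟨h, rfl⟩ := x.exists_sndVal_eq hy
      exact ⟨.inl h, rfl⟩

variable (hv : ∀ h, Γ₂.vertexOf h = v.1 ↔ x.sndVal h ∈ x.sub.1.support)
  (hσ : ∀ h : v.Flag,
    x.fst.toEquiv (σ h).1 = .inr ⟨x.sndVal h.1, (hv h.1).1 h.2, x.sndVal_not_mem h.1⟩)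

include hσ in
theorem insertAttach_of_mem_support (w : (Γ₁.insert Γ₂ v σ).HalfEdge)
    (hw : x.insertMap v σ w ∈ x.sub.1.support) :
    insertAttach Γ₁ Γ₂ v σ w = .inr (x.core _ hw) := by
  rcases w with h | k
  · have hh := (hv h).2 hw
    rw [insertAttach_inl_of_eq v σ h hh]
    refine congrArg Sum.inr ((Equiv.eq_symm_apply _).2 ?_)
    exact (x.fst.map_mate _).trans (congrArg x.sub.1.toGraph.mate (hσ ⟨h, hh⟩))
  · exact congrArg Sum.inr ((Equiv.eq_symm_apply _).2 (x.fst_internal k.2))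

include hv in
theorem insertAttach_of_not_mem_support (w : (Γ₁.insert Γ₂ v σ).HalfEdge)
    (hw : x.insertMap v σ w ∉ x.sub.1.support) :
    ∃ h, insertAttach Γ₁ Γ₂ v σ w = .inl h ∧ x.sndVal h = x.insertMap v σ w := by
  rcases w with h | k
  · exact ⟨h, insertAttach_inl_of_ne v σ h fun hh => hw ((hv h).1 hh), rfl⟩
  · exact absurd (x.sub.1.carrier_subset_support (x.fstVal_internal_mem k.2)) hw

/-- Inserting the subgraph into its contraction gives back the ambient graph. -/
noncomputable def insertIso : Iso (Γ₁.insert Γ₂ v σ) Γ where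
  toEquiv := Equiv.ofBijective _ (x.insertMap_bijective v σ)
  map_mate := by
    rintro (h | k)
    · exact congrArg Subtype.val (x.snd.map_mate h)
    · change x.sub.1.val (x.fst.toEquiv (Γ₁.mate k.1)) = Γ.mate (x.fstVal k.1)
      rw [x.fst.map_mate, x.fst_internal k.2,
        Subgraph.toGraph_mate_inl_mem _ _ (x.fstVal_internal_mem k.2)]
      rfl
  map_vert a b := by
    change sumSetoid Γ₂.vert Γ₁.vert (insertAttach Γ₁ Γ₂ v σ a) (insertAttach Γ₁ Γ₂ v σ b) ↔
      Γ.vert (x.insertMap v σ a) (x.insertMap v σ b)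
    by_cases ha : x.insertMap v σ a ∈ x.sub.1.support <;>
      by_cases hb : x.insertMap v σ b ∈ x.sub.1.support
    · rw [x.insertAttach_of_mem_support v σ hv hσ a ha,
        x.insertAttach_of_mem_support v σ hv hσ b hb, sumSetoid_inr_inr, x.fst.map_vert,
        fst_core, fst_core]
      rfl
    · obtain ⟨h, h1, -⟩ := x.insertAttach_of_not_mem_support v σ hv b hb
      rw [x.insertAttach_of_mem_support v σ hv hσ a ha, h1]
      exact iff_of_false id fun h => hb (x.sub.1.mem_support_of_vert ha h)
    · obtain ⟨h, h1, -⟩ := x.insertAttach_of_not_mem_support v σ hv a ha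
      rw [x.insertAttach_of_mem_support v σ hv hσ b hb, h1]
      exact iff_of_false id fun h => ha (x.sub.1.mem_support_of_vert hb (Γ.vert.symm h))
    · obtain ⟨h, h1, h2⟩ := x.insertAttach_of_not_mem_support v σ hv a ha
      obtain ⟨h', h1', h2'⟩ := x.insertAttach_of_not_mem_support v σ hv b hb
      rw [h1, h1', ← h2, ← h2', sumSetoid_inl_inl, vert_iff_merge]
      rw [← h2] at ha
      exact ⟨Subgraph.vert_of_merge _ ha, fun h => .rel _ _ (Or.inl h)⟩
  map_ext := by
    rintro (h | k)
    · refine Iff.trans ?_ (x.snd.map_ext h)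
      exact ⟨fun ⟨_, h, he⟩ => Sum.inl_injective he ▸ h, fun h => ⟨_, h, rfl⟩⟩
    · refine iff_of_false (fun ⟨_, _, h⟩ => by cases h) ?_
      exact (x.sub.1.internal _ (x.fstVal_internal_mem k.2)).1

end

end Extraction

/-- The preimage reinserts the subgraph at the vertex to which it was contracted, with `σ` matching
half-edges and external vertices that have the same underlying half-edge in `Γ`. Then `sndVal`
agrees by definition, and `fstVal` is checked on external vertices, on their mates and on internal
half-edges. -/
theorem Insertion.toExtraction_surjective (hΓ : Γ.Connected) (hc : Γ₁.Connected)
    (hi₁ : Γ₁.HasInternalEdge) (hi₂ : Γ₂.HasInternalEdge) :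
    Function.Surjective (toExtraction (Γ := Γ) hc hi₁ hi₂) := by
  intro x
  obtain ⟨v, hv⟩ := x.exists_vertex hΓ hc
  obtain ⟨σ, hσ⟩ := x.exists_flagEquiv v hv
  let y : Insertion Γ₁ Γ₂ Γ := ⟨v, σ, x.insertIso v σ hv hσ⟩
  have hext : ∀ e ∈ Γ₁.ext, (y.toExtraction hc hi₁ hi₂).fstVal e = x.fstVal e := by
    intro e he
    obtain ⟨h, hh⟩ : ∃ h, σ h = ⟨e, he⟩ := σ.surjective _
    have h1 : (σ h).1 = e := congrArg Subtype.val hh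
    rw [← h1]
    refine (toExtraction_fstVal_ext hc hi₁ hi₂ y h.1 h.2).trans ?_
    change x.sndVal h.1 = x.sub.1.val (x.fst.toEquiv (σ h).1)
    rw [hσ]
    rfl
  -- The two ends of an external edge of a subgraph have the same underlying half-edge.
  have hmate : ∀ (z : Extraction Γ₁ Γ₂ Γ) {e : Γ₁.HalfEdge}, e ∈ Γ₁.ext →
      z.fstVal (Γ₁.mate e) = z.fstVal e := by
    intro z e he
    obtain ⟨w, hw⟩ := (z.fst.map_ext e).1 he
    change z.sub.1.val (z.fst.toEquiv (Γ₁.mate e)) = z.sub.1.val (z.fst.toEquiv e)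
    rw [z.fst.map_mate, ← hw]
    rfl
  refine ⟨y, Extraction.ext_val (funext fun e => ?_) rfl⟩
  by_cases he : e ∈ Γ₁.ext
  · exact hext e he
  · by_cases hm : Γ₁.mate e ∈ Γ₁.ext
    · rw [← Γ₁.mate_mate e, hmate _ hm, hmate _ hm, hext _ hm]
    · exact toExtraction_fstVal_internal hc hi₁ hi₂ y ⟨e, he, hm⟩

/-! ### Counting -/

open Classical in
-- The isomorphisms between two graphs form either the empty set or a torsor under the automorphism
-- group.
theorem card_iso (Γ Γ' : FGraph) :
    Nat.card (Iso Γ Γ') = if Γ'.cls = Γ.cls then Γ.autCard else 0 := by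
  split_ifs with h
  · obtain ⟨e⟩ : Nonempty (Iso Γ' Γ) := Quotient.exact (s := isoSetoid) h
    refine Nat.card_congr ⟨fun f => f.trans e, fun f => f.trans e.symm, fun f => ?_, fun f => ?_⟩
    <;>
    · apply Iso.toEquiv_injective
      ext x
      simp [Iso.trans, Iso.symm]
  · have : IsEmpty (Iso Γ Γ') := ⟨fun e => h (cls_eq_of_iso e).symm⟩
    exact Nat.card_of_isEmpty

/-- An extraction as a dependent tuple. -/
def extractionEquiv (Γ₁ Γ₂ Γ : FGraph) : Extraction Γ₁ Γ₂ Γ ≃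
    Σ γ : {γ : Γ.Subgraph // γ.Nontrivial}, Iso Γ₁ γ.1.toGraph × Iso Γ₂ (Γ.contract γ.1) where
  toFun x := ⟨x.sub, x.fst, x.snd⟩
  invFun x := ⟨x.1, x.2.1, x.2.2⟩
  left_inv _ := rfl
  right_inv _ := rfl

/-- An insertion as a dependent tuple. -/
def insertionEquiv (Γ₁ Γ₂ Γ : FGraph) : Insertion Γ₁ Γ₂ Γ ≃
    Σ v : Γ₂.IntVertex, Σ σ : v.Flag ≃ Γ₁.ext, Iso (Γ₁.insert Γ₂ v σ) Γ where
  toFun x := ⟨x.vertex, x.bij, x.iso⟩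
  invFun x := ⟨x.1, x.2.1, x.2.2⟩
  left_inv _ := rfl
  right_inv _ := rfl

open Classical in
/-- Double counting of the ways of obtaining `Γ` by inserting `Γ₁` into `Γ₂`. -/
theorem sum_extraction_eq_sum_insertion (hΓ : Γ.Connected) (hc : Γ₁.Connected)
    (hi₁ : Γ₁.HasInternalEdge) (hi₂ : Γ₂.HasInternalEdge) :
    ∑ γ : {γ : Γ.Subgraph // γ.Nontrivial},
      (if γ.1.toGraph.cls = Γ₁.cls then Γ₁.autCard else 0) *
        (if (Γ.contract γ.1).cls = Γ₂.cls then Γ₂.autCard else 0) =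
      Γ.autCard * ∑ v : Γ₂.IntVertex, ∑ σ : v.Flag ≃ Γ₁.ext,
        if Γ.cls = (Γ₁.insert Γ₂ v σ).cls then 1 else 0 := by
  have h1 := Nat.card_congr (Equiv.ofBijective _
    ⟨Insertion.toExtraction_injective (Γ := Γ) hc hi₁ hi₂,
      Insertion.toExtraction_surjective hΓ hc hi₁ hi₂⟩)
  rw [Nat.card_congr (extractionEquiv _ _ _), Nat.card_congr (insertionEquiv _ _ _),
    Nat.card_sigma, Nat.card_sigma] at h1
  simp only [Nat.card_sigma, Nat.card_prod, card_iso] at h1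
  rw [← h1, Finset.mul_sum]
  refine Finset.sum_congr rfl fun v _ => ?_
  rw [Finset.mul_sum]
  refine Finset.sum_congr rfl fun σ _ => ?_
  split_ifs with h
  -- Counting isomorphisms produces the automorphisms of the insertion, which number as many as
  -- those of the isomorphic graph `Γ`.
  · rw [mul_one, ← GraphClass.autCard_cls, ← GraphClass.autCard_cls, h]
  · rfl

/-! ### Factorizations of graph classes -/

theorem cls_eq_one_iff (Γ : FGraph) : Γ.cls = 1 ↔ IsEmpty Γ.HalfEdge := by
  constructor
  · intro h
    obtain ⟨e⟩ : Nonempty (Iso Γ FGraph.empty) := Quotient.exact (s := isoSetoid) h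
    exact ⟨fun x => (e.toEquiv x : Empty).elim⟩
  · intro h
    exact cls_eq_of_iso ⟨Equiv.equivOfIsEmpty _ Empty, fun x => h.elim x, fun x => h.elim x,
      fun x => h.elim x⟩

theorem Connected.cls_ne_one (hΓ : Γ.Connected) : Γ.cls ≠ 1 := fun h =>
  not_isEmpty_iff.2 hΓ.1 ((cls_eq_one_iff Γ).1 h)

/-- Two nonempty factors would give half-edges in different components of the union. -/
theorem Connected.eq_one_or_eq_one (hΓ : Γ.Connected) {a b : GraphClass} (h : a * b = Γ.cls) :
    a = 1 ∨ b = 1 := by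
  obtain ⟨A⟩ := a
  obtain ⟨B⟩ := b
  obtain ⟨e⟩ : Nonempty (Iso Γ (A.union B)) := Quotient.exact (s := isoSetoid) h.symm
  have hAB := hΓ.of_iso e
  by_contra! hne
  obtain ⟨x⟩ := not_isEmpty_iff.1 (fun h => hne.1 ((cls_eq_one_iff A).2 h))
  obtain ⟨y⟩ := not_isEmpty_iff.1 (fun h => hne.2 ((cls_eq_one_iff B).2 h))
  exact component_union_inl_ne_inr A B x y (Quotient.sound (hAB.2 _ _))

end FGraph

theorem GraphClass.mul_eq_one_iff (a b : GraphClass) : a * b = 1 ↔ a = 1 ∧ b = 1 := by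
  constructor
  · obtain ⟨A⟩ := a
    obtain ⟨B⟩ := b
    intro h
    have h1 := (FGraph.cls_eq_one_iff (A.union B)).1 h
    exact ⟨(FGraph.cls_eq_one_iff A).2 ⟨fun x => h1.elim (.inl x)⟩,
      (FGraph.cls_eq_one_iff B).2 ⟨fun x => h1.elim (.inr x)⟩⟩
  · rintro ⟨rfl, rfl⟩
    exact mul_one 1

section Hopf

open FGraph

variable (K : Type*) [Field K]

/-! ### The counit -/

open Classical in
/-- The counit of the algebra of graphs. -/
noncomputable def graphCounit : GraphAlgebra K →ₐ[K] K :=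
  MonoidAlgebra.lift K K GraphClass
    { toFun := fun c => if c = 1 then 1 else 0
      map_one' := if_pos rfl
      map_mul' := fun a b => by
        by_cases ha : a = 1 <;> by_cases hb : b = 1 <;>
          simp [GraphClass.mul_eq_one_iff, ha, hb] }

open Classical in
theorem graphCounit_of (c : GraphClass) :
    graphCounit K (GraphAlgebra.of K c) = if c = 1 then 1 else 0 := by
  rw [graphCounit, GraphAlgebra.of, MonoidAlgebra.lift_of]
  rfl

theorem GraphAlgebra.of_one : GraphAlgebra.of K 1 = 1 := map_one (MonoidAlgebra.of K GraphClass)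

theorem GraphAlgebra.of_mul (a b : GraphClass) :
    GraphAlgebra.of K (a * b) = GraphAlgebra.of K a * GraphAlgebra.of K b :=
  map_mul (MonoidAlgebra.of K GraphClass) a b

/-- The algebra map `ε ⊗ id`. -/
noncomputable def counitLeft : GraphAlgebra K ⊗[K] GraphAlgebra K →ₐ[K] GraphAlgebra K :=
  Algebra.TensorProduct.lift ((Algebra.ofId K (GraphAlgebra K)).comp (graphCounit K))
    (AlgHom.id K _) fun _ _ => Commute.all _ _

/-- The algebra map `id ⊗ ε`. -/
noncomputable def counitRight : GraphAlgebra K ⊗[K] GraphAlgebra K →ₐ[K] GraphAlgebra K :=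
  Algebra.TensorProduct.lift (AlgHom.id K _)
    ((Algebra.ofId K (GraphAlgebra K)).comp (graphCounit K)) fun _ _ => Commute.all _ _

theorem counitLeft_tmul (x y : GraphAlgebra K) :
    counitLeft K (x ⊗ₜ y) = graphCounit K x • y := by
  rw [counitLeft, Algebra.TensorProduct.lift_tmul, Algebra.smul_def]
  rfl

theorem counitRight_tmul (x y : GraphAlgebra K) :
    counitRight K (x ⊗ₜ y) = graphCounit K y • x := by
  rw [counitRight, Algebra.TensorProduct.lift_tmul, Algebra.smul_def, mul_comm]
  rfl

theorem graphCounit_of_nonempty (Γ : FGraph) [h : Nonempty Γ.HalfEdge] :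
    graphCounit K (GraphAlgebra.of K Γ.cls) = 0 := by
  rw [graphCounit_of, if_neg]
  rw [cls_eq_one_iff]
  exact not_isEmpty_iff.2 h

theorem FGraph.Subgraph.Nontrivial.nonempty_toGraph {Γ : FGraph} {γ : Γ.Subgraph}
    (hγ : γ.Nontrivial) : Nonempty γ.toGraph.HalfEdge := by
  obtain ⟨⟨s, hs⟩, -⟩ := hγ
  exact ⟨.inl ⟨s, γ.carrier_subset_support hs⟩⟩

theorem FGraph.Subgraph.Nontrivial.nonempty_contract {Γ : FGraph} {γ : Γ.Subgraph}
    (hγ : γ.Nontrivial) : Nonempty (Γ.contract γ).HalfEdge := by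
  obtain ⟨-, h, -, hh⟩ := hγ
  exact ⟨⟨h, hh⟩⟩

/-- Only `1 ⊗ Γ` survives, because `Γ` and every nontrivial `γ` are nonempty. With its mirror image
this says that `ε ⊗ id` and `id ⊗ ε` agree on the coproduct of a component. -/
theorem counitLeft_coprodFormula (Γ : FGraph) [Nonempty Γ.HalfEdge] :
    counitLeft K (Γ.coprodFormula K) = GraphAlgebra.of K Γ.cls := by
  have h : ∀ γ : {γ : Γ.Subgraph // γ.Nontrivial},
      graphCounit K (GraphAlgebra.of K γ.1.toGraph.cls) = 0 := fun γ =>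
    graphCounit_of_nonempty K _ (h := γ.2.nonempty_toGraph)
  simp [coprodFormula, counitLeft_tmul, graphCounit_of_nonempty, h]

theorem counitRight_coprodFormula (Γ : FGraph) [Nonempty Γ.HalfEdge] :
    counitRight K (Γ.coprodFormula K) = GraphAlgebra.of K Γ.cls := by
  have h : ∀ γ : {γ : Γ.Subgraph // γ.Nontrivial},
      graphCounit K (GraphAlgebra.of K (Γ.contract γ.1).cls) = 0 := fun γ =>
    graphCounit_of_nonempty K _ (h := γ.2.nonempty_contract)
  simp [coprodFormula, counitRight_tmul, graphCounit_of_nonempty, h]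

/-! ### Infinitesimal characters -/

/-- Infinitesimal characters: linear forms which are derivations with respect to the counit. -/
def IsInfinitesimal (ξ : Module.Dual K (GraphAlgebra K)) : Prop :=
  ∀ x y, ξ (x * y) = graphCounit K x * ξ y + ξ x * graphCounit K y

/-- The tensor product of two linear forms. -/
noncomputable def pairing (ξ η : Module.Dual K (GraphAlgebra K)) :
    Module.Dual K (GraphAlgebra K ⊗[K] GraphAlgebra K) :=
  LinearMap.mul' K K ∘ₗ TensorProduct.map ξ η

theorem pairing_tmul (ξ η : Module.Dual K (GraphAlgebra K)) (x y : GraphAlgebra K) :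
    pairing K ξ η (x ⊗ₜ y) = ξ x * η y := rfl

variable {K} in
-- Expanding both derivation rules on pure tensors gives four terms. The outer two vanish when `ε ⊗
-- ε` kills both factors, and the middle two are exchanged by swapping `ξ` and `η` when the
-- one-sided counits agree.
theorem pairing_mul {ξ η : Module.Dual K (GraphAlgebra K)} (hξ : IsInfinitesimal K ξ)
    (hη : IsInfinitesimal K η) (X Y : GraphAlgebra K ⊗[K] GraphAlgebra K) :
    pairing K ξ η (X * Y) =
      graphCounit K (counitLeft K X) * pairing K ξ η Y + η (counitLeft K X) * ξ (counitRight K Y) +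
        ξ (counitRight K X) * η (counitLeft K Y) +
          pairing K ξ η X * graphCounit K (counitLeft K Y) := by
  induction X using TensorProduct.induction_on with
  | zero => simp
  | add X X' hX hX' =>
    simp only [add_mul, map_add, hX, hX']
    ring
  | tmul a b =>
    induction Y using TensorProduct.induction_on with
    | zero => simp
    | add Y Y' hY hY' =>
      simp only [mul_add, map_add, hY, hY']
      ring
    | tmul c d =>
      simp only [Algebra.TensorProduct.tmul_mul_tmul, pairing_tmul, counitLeft_tmul,
        counitRight_tmul, map_smul, smul_eq_mul, hξ a c, hη b d]
      ring

variable {K} in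
/-- The tensor product of two infinitesimal characters is symmetric on products of
elements of `ker (ε ⊗ ε)` on which `ε ⊗ id` and `id ⊗ ε` agree. -/
theorem pairing_mul_comm {ξ η : Module.Dual K (GraphAlgebra K)} (hξ : IsInfinitesimal K ξ)
    (hη : IsInfinitesimal K η) {X Y : GraphAlgebra K ⊗[K] GraphAlgebra K}
    (hX : counitLeft K X = counitRight K X) (hY : counitLeft K Y = counitRight K Y)
    (hX' : graphCounit K (counitLeft K X) = 0) (hY' : graphCounit K (counitLeft K Y) = 0) :
    pairing K ξ η (X * Y) = pairing K η ξ (X * Y) := by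
  rw [pairing_mul hξ hη, pairing_mul hη hξ, hX', hY', hX, hY]
  ring

theorem nabla_of_cls (Γ : FGraph) : nabla K (GraphAlgebra.of K Γ.cls) = Γ.coprod K := by
  rw [nabla, GraphAlgebra.of, MonoidAlgebra.lift_of]
  rfl

/-- A nonempty disconnected graph splits as one component and a nonempty remainder, whose coproducts
satisfy the hypotheses of `pairing_mul_comm`. The empty graph is also not connected and is treated
apart: its coproduct is `1 ⊗ 1`, and infinitesimal characters vanish at `1`. -/
theorem pairing_coprod_comm {Γ : FGraph} (hΓ : ¬ Γ.Connected)
    {ξ η : Module.Dual K (GraphAlgebra K)} (hξ : IsInfinitesimal K ξ)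
    (hη : IsInfinitesimal K η) :
    pairing K ξ η (Γ.coprod K) = pairing K η ξ (Γ.coprod K) := by
  classical
  have hne : ∀ c : Γ.Component, Nonempty c.toGraph.HalfEdge := fun c =>
    let ⟨h, hh⟩ := c.exists_rep
    ⟨⟨h, hh⟩⟩
  have hlr : ∀ s : Finset Γ.Component, counitLeft K (∏ c ∈ s, c.toGraph.coprodFormula K) =
      counitRight K (∏ c ∈ s, c.toGraph.coprodFormula K) := fun s => by
    simp only [map_prod, counitLeft_coprodFormula, counitRight_coprodFormula]
  have hzero : ∀ s : Finset Γ.Component, s.Nonempty →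
      graphCounit K (counitLeft K (∏ c ∈ s, c.toGraph.coprodFormula K)) = 0 := by
    rintro s ⟨c, hc⟩
    simp only [map_prod, counitLeft_coprodFormula]
    exact Finset.prod_eq_zero hc (graphCounit_of_nonempty K _)
  rcases isEmpty_or_nonempty Γ.HalfEdge with h | ⟨⟨a⟩⟩
  · have : IsEmpty Γ.Component := ⟨fun c => h.elim c.exists_rep.choose⟩
    have hone : ∀ ζ : Module.Dual K (GraphAlgebra K), IsInfinitesimal K ζ → ζ 1 = 0 := by
      intro ζ hζ
      have h1 := hζ 1 1
      rw [mul_one, map_one (graphCounit K), one_mul, mul_one] at h1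
      exact left_eq_add.1 h1
    rw [coprod, Fintype.prod_empty, Algebra.TensorProduct.one_def, pairing_tmul, pairing_tmul,
      hone ξ hξ, hone η hη]
  · obtain ⟨b, hb⟩ : ∃ b, Γ.component b ≠ Γ.component a := by
      by_contra! hall
      exact hΓ ⟨⟨a⟩, fun x y => Quotient.exact ((hall x).trans (hall y).symm)⟩
    have hsplit : Γ.coprod K = (∏ c ∈ {Γ.component a}, c.toGraph.coprodFormula K) *
        ∏ c ∈ Finset.univ.erase (Γ.component a), c.toGraph.coprodFormula K := by
      rw [Finset.prod_singleton]
      exact (Finset.mul_prod_erase _ (fun c : Γ.Component => c.toGraph.coprodFormula K)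
        (Finset.mem_univ (Γ.component a))).symm
    rw [hsplit]
    exact pairing_mul_comm hξ hη (hlr _) (hlr _) (hzero _ ⟨_, Finset.mem_singleton_self _⟩)
      (hzero _ ⟨Γ.component b, Finset.mem_erase.2 ⟨hb, Finset.mem_univ _⟩⟩)

/-! ### Comparison of the coefficients of the star product and the insertion product -/

open Classical in
theorem circ_apply (Γ₁ Γ₂ : FGraph) (c : GraphClass) :
    circ K Γ₁ Γ₂ c = ∑ v : Γ₂.IntVertex, ∑ σ : v.Flag ≃ Γ₁.ext,
      if c = (Γ₁.insert Γ₂ v σ).cls then 1 else 0 := by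
  simp only [circ, insertAt, Finset.sum_apply, GraphSeries.of, Pi.single_apply]

theorem circ_apply_of_not_connected {Γ₁ Γ₂ Γ : FGraph} (hΓ : ¬ Γ.Connected)
    (hc₁ : Γ₁.Connected) (hc₂ : Γ₂.Connected) (hi₁ : Γ₁.HasInternalEdge) :
    circ K Γ₁ Γ₂ Γ.cls = 0 := by
  classical
  rw [circ_apply]
  refine Finset.sum_eq_zero fun v _ => Finset.sum_eq_zero fun σ _ => if_neg fun h => hΓ ?_
  obtain ⟨e⟩ : Nonempty (Iso (Γ₁.insert Γ₂ v σ) Γ) := Quotient.exact (s := isoSetoid) h.symm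
  exact (insert_connected v σ hc₁ hi₁ hc₂).of_iso e

variable [CharZero K]

open Classical in
theorem dualIso_of (Γ : FGraph) (c : GraphClass) :
    dualIso K (GraphSeries.of K Γ) (GraphAlgebra.of K c) =
      if c = Γ.cls then (Γ.autCard : K) else 0 := by
  rw [dualIso_apply, GraphSeries.of, Pi.single_apply]
  split_ifs with h
  · rw [h, mul_one, GraphClass.autCard_cls]
  · rw [mul_zero]

/-- The form is supported on the class of `Γ`, which is not a product of two nonempty classes. So it
vanishes on such products and on `1`, and the rule follows on basis elements and then by
bilinearity. -/
theorem isInfinitesimal_dualIso_of {Γ : FGraph} (hΓ : Γ.Connected) :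
    IsInfinitesimal K (dualIso K (GraphSeries.of K Γ)) := by
  have key : ∀ a b : GraphClass, dualIso K (GraphSeries.of K Γ)
      (GraphAlgebra.of K a * GraphAlgebra.of K b) =
      graphCounit K (GraphAlgebra.of K a) * dualIso K (GraphSeries.of K Γ) (GraphAlgebra.of K b) +
        dualIso K (GraphSeries.of K Γ) (GraphAlgebra.of K a) *
          graphCounit K (GraphAlgebra.of K b) := by
    intro a b
    have hone : dualIso K (GraphSeries.of K Γ) 1 = 0 := by
      rw [← GraphAlgebra.of_one, dualIso_of, if_neg hΓ.cls_ne_one.symm]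
    by_cases ha : a = 1
    · rw [ha, GraphAlgebra.of_one, one_mul, map_one, one_mul, hone, zero_mul, add_zero]
    · by_cases hb : b = 1
      · rw [hb, GraphAlgebra.of_one, mul_one, map_one (graphCounit K), hone,
          mul_zero, zero_add, mul_one]
      · have hab : a * b ≠ Γ.cls := fun h => (hΓ.eq_one_or_eq_one h).elim ha hb
        rw [← GraphAlgebra.of_mul, dualIso_of, if_neg hab, graphCounit_of, graphCounit_of,
          if_neg ha, if_neg hb, zero_mul, mul_zero, add_zero]
  intro x y
  induction x using MonoidAlgebra.induction_on with
  | of a =>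
    induction y using MonoidAlgebra.induction_on with
    | of b => exact key a b
    | add y y' hy hy' =>
      simp only [mul_add, map_add, hy, hy']
      ring
    | smul r y hy =>
      simp only [mul_smul_comm, map_smul, smul_eq_mul, hy]
      ring
  | add x x' hx hx' =>
    simp only [add_mul, map_add, hx, hx']
    ring
  | smul r x hx =>
    simp only [smul_mul_assoc, map_smul, smul_eq_mul, hx]
    ring

theorem autCard_mul_starProd (x y : GraphSeries K) (c : GraphClass) :
    (c.autCard : K) * starProd K x y c =
      pairing K (dualIso K x) (dualIso K y) (nabla K (GraphAlgebra.of K c)) := by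
  rw [← dualIso_apply, starProd, LinearEquiv.apply_symm_apply]
  rfl

/-- On connected graphs, the product `⋆` is given by insertions. -/
theorem starProd_apply_of_connected {Γ₁ Γ₂ Γ : FGraph} (hΓ : Γ.Connected)
    (hc₁ : Γ₁.Connected) (hc₂ : Γ₂.Connected)
    (hi₁ : Γ₁.HasInternalEdge) (hi₂ : Γ₂.HasInternalEdge) :
    starProd K (GraphSeries.of K Γ₁) (GraphSeries.of K Γ₂) Γ.cls = circ K Γ₁ Γ₂ Γ.cls := by
  classical
  refine mul_left_cancel₀ (Nat.cast_ne_zero (R := K).2 Γ.cls.autCard_ne_zero) ?_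
  rw [autCard_mul_starProd, nabla_of_connected K Γ hΓ, coprodFormula, circ_apply,
    GraphClass.autCard_cls]
  have h := congrArg (Nat.cast (R := K)) (sum_extraction_eq_sum_insertion hΓ hc₁ hi₁ hi₂)
  push_cast at h
  rw [← h]
  -- The forms dual to the nonempty graphs `Γ₁` and `Γ₂` vanish at `1`, which removes `1 ⊗ Γ` and `Γ
  -- ⊗ 1`; what remains is the weighted count of subgraphs.
  simp only [map_add, map_sum, pairing_tmul, ← GraphAlgebra.of_one, dualIso_of,
    hc₁.cls_ne_one.symm, hc₂.cls_ne_one.symm, if_false, zero_mul, mul_zero, zero_add]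

end Hopf

theorem mainTheorem5 (K : Type*) [Field K] [CharZero K] (Γ₁ Γ₂ : FGraph)
    (hc₁ : Γ₁.Connected) (hc₂ : Γ₂.Connected)
    (hi₁ : Γ₁.HasInternalEdge) (hi₂ : Γ₂.HasInternalEdge) :
    starBracket K (GraphSeries.of K Γ₁) (GraphSeries.of K Γ₂) =
      FGraph.circ K Γ₁ Γ₂ - FGraph.circ K Γ₂ Γ₁ := by
  funext c
  obtain ⟨Γ, rfl⟩ : ∃ Γ : FGraph, Γ.cls = c := Quotient.exists_rep c
  rw [starBracket, Pi.sub_apply, Pi.sub_apply]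
  by_cases hΓ : Γ.Connected
  · rw [starProd_apply_of_connected K hΓ hc₁ hc₂ hi₁ hi₂,
      starProd_apply_of_connected K hΓ hc₂ hc₁ hi₂ hi₁]
  · rw [circ_apply_of_not_connected K hΓ hc₁ hc₂ hi₁, circ_apply_of_not_connected K hΓ hc₂ hc₁ hi₂,
      sub_zero, sub_eq_zero]
    refine mul_left_cancel₀ (Nat.cast_ne_zero (R := K).2 Γ.cls.autCard_ne_zero) ?_
    rw [autCard_mul_starProd, autCard_mul_starProd, nabla_of_cls]
    exact pairing_coprod_comm K hΓ (isInfinitesimal_dualIso_of K hc₁)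
      (isInfinitesimal_dualIso_of K hc₂)
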